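/- Let $p$ be a prime with $5<p<2^5$ and $p\neq 17$, and let $K$ be an (unoriented) knot. A Dehn $p$-coloring of a diagram $D$ of $K$ is a map $C$ from the set of regions of $D$ to $\mathbb Z/p$ such that, at each crossing, $C(x_1)+C(x_3)=C(x_2)+C(x_4)$, where $x_1,x_2,x_3,x_4$ are the four regions at the crossing, $x_2$ is adjacent to $x_1$ by an under-arc, $x_3$ is adjacent to $x_1$ by the over-arc, and $x_4$ is opposite to $x_1$. It is nontrivial if at some crossing it is not the case that $C(x_1)=C(x_4)$ and $C(x_2)=C(x_3)$. The knot $K$ is Dehn $p$-colorable if some diagram of $K$ has a nontrivial Dehn $p$-coloring, and then $\mathrm{mincol}_p(K)$ denotes the minimum of $\#\,\mathrm{Im}(C)$ over all diagrams $D$ of $K$ and all nontrivial Dehn $p$-colorings $C$ of $D$. Let $R_p$ be the dihedral quandle of order $p$, that is, $\mathbb Z/p$ with $x*y=2y-x$, and let $$\theta_p^{\rm M}(x,y,z)=(x-y)\,\frac{(2z-y)^p+y^p-2z^p}{p}\in\mathbb Z/p$$ be Mochizuki's $3$-cocycle of $R_p$ (the fraction is computed with integer representatives). Orient $D$ arbitrarily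 and let normal vectors point to the left. A shadow $R_p$-coloring of $D$ assigns elements of $R_p$ to the arcs and to the regions of $D$ so that crossing an arc colored $y$ in the direction of its normal vector changes the color $x$ of a region, or of an under-arc at a crossing, into $x*y$; it is nontrivial if its arcs are not all of the same color. Its weight is $\sum_\chi \varepsilon_\chi\,\theta_p^{\rm M}(x_\chi,y_\chi,z_\chi)$ over all crossings $\chi$, where $\varepsilon_\chi$ is the sign of $\chi$, $x_\chi$ is the color of the region at $\chi$ from which both normal vectors point, $y_\chi$ is the color of the under-arc from which the normal vector of the over-arc points, and $z_\chi$ is the color of the over-arc. The shadow quandle cocycle invariant $\tilde\Phi^{\rm NT}_{\theta_p^{\rm M}}(K)$ is the multiset of the weights of all nontrivial shadow $R_p$-colorings of $D$, where $D$ is any diagram of $K$ with any orientation. If $K$ is Dehn $p$-colorable and $0\notin\tilde\Phi^{\rm NT}_{\theta_p^{\rm M}}(K)$, then $$\mathrm{mincol}_p(K)\ \ge\ \lfloor \log_2 p\rfloor+3 .$$ -/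

import Mathlib

/-! ### Knot diagrams

An oriented knot diagram on the sphere is recorded by its signed Gauss code: cut the knot at a point
that is not a crossing, walk once along it, and write down the passes through the crossings. -/

/-- One passage of the knot through a crossing: the label of the crossing, whether the passage is
along the over-strand, and whether the crossing is positive. -/
@[ext] structure Pass where
  crossing : ℕ
  isOver : Bool
  isPositive : Bool

namespace Pass

/-- The other passage through the same crossing. -/
def other (x : Pass) : Pass := ⟨x.crossing, !x.isOver, x.isPositive⟩

/-- Rename the crossing. -/
def relabel (f : ℕ → ℕ) (x : Pass) : Pass := ⟨f x.crossing, x.isOver, x.isPositive⟩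

end Pass

/-- Every crossing of the word is passed exactly twice, once over and once under, and both passages
carry the same sign. -/
def IsGaussCode (w : List Pass) : Prop :=
  (w.map fun x => (x.crossing, x.isOver)).Nodup ∧ ∀ x ∈ w, x.other ∈ w

/-- The pass at position `j` is the over-pass, and the pass at position `i` the under-pass, of one
and the same crossing. -/
def IsCrossing (w : List Pass) (j i : Fin w.length) : Prop :=
  (w.get j).isOver = true ∧ w.get i = (w.get j).other

/-- Semiarcs. The pass at position `i : Fin w.length` is entered along the semiarc `i.castSucc` and
left along the semiarc `i.succ`. The first and the last semiarc are the two halves of the semiarc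
that has been cut. -/
abbrev Semiarc (w : List Pass) : Type := Fin (w.length + 1)

/-- The two sides of a semiarc with respect to the orientation of the knot. -/
inductive Side : Type
  | left
  | right

/-- Two sides of semiarcs belong to the same region because they meet at the cut point, or in one of
the four corners of a crossing. At a positive crossing the under-strand runs from the right of the
over-strand to its left; at a negative crossing it runs from the left to the right. -/
inductive Adjoin (w : List Pass) : Semiarc w × Side → Semiarc w × Side → Prop
  | cut (s : Side) : Adjoin w (Fin.last w.length, s) (0, s)
  | pos_in_left (j i : Fin w.length) (h : IsCrossing w j i) (hs : (w.get j).isPositive = true) :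
      Adjoin w (j.castSucc, .left) (i.succ, .left)
  | pos_in_right (j i : Fin w.length) (h : IsCrossing w j i) (hs : (w.get j).isPositive = true) :
      Adjoin w (j.castSucc, .right) (i.castSucc, .left)
  | pos_out_left (j i : Fin w.length) (h : IsCrossing w j i) (hs : (w.get j).isPositive = true) :
      Adjoin w (j.succ, .left) (i.succ, .right)
  | pos_out_right (j i : Fin w.length) (h : IsCrossing w j i) (hs : (w.get j).isPositive = true) :
      Adjoin w (j.succ, .right) (i.castSucc, .right)
  | neg_in_left (j i : Fin w.length) (h : IsCrossing w j i) (hs : (w.get j).isPositive = false) :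
      Adjoin w (j.castSucc, .left) (i.castSucc, .right)
  | neg_in_right (j i : Fin w.length) (h : IsCrossing w j i) (hs : (w.get j).isPositive = false) :
      Adjoin w (j.castSucc, .right) (i.succ, .right)
  | neg_out_left (j i : Fin w.length) (h : IsCrossing w j i) (hs : (w.get j).isPositive = false) :
      Adjoin w (j.succ, .left) (i.castSucc, .left)
  | neg_out_right (j i : Fin w.length) (h : IsCrossing w j i) (hs : (w.get j).isPositive = false) :
      Adjoin w (j.succ, .right) (i.succ, .left)

/-- The regions of the diagram, i.e. the components of the complement of the underlying curve. -/
def Region (w : List Pass) : Type := Quot (Adjoin w)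

/-- The region on the given side of a semiarc. -/
def region {w : List Pass} (u : Semiarc w) (s : Side) : Region w := Quot.mk _ (u, s)

/-- A knot diagram with `n` crossings on the sphere: a signed Gauss code whose underlying
4-valent graph, with `n` vertices and `2 n` edges, has Euler characteristic `n - 2 n + (n + 2) = 2`.
The empty word is the diagram without crossings. -/
structure KnotDiagram where
  word : List Pass
  gauss : IsGaussCode word
  planar : Nat.card (Region word) = word.length / 2 + 2

/-! ### Reidemeister moves and knots -/

/-- Two passes in the given order, or in the opposite order. -/
def pairInOrder (inOrder : Bool) (x y : Pass) : List Pass := if inOrder then [x, y] else [y, x]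

/-- Elementary changes of a signed Gauss code: change of the cut point, of the names of the
crossings and of the orientation of the knot, and the three Reidemeister moves.

In a move of type III a top, a middle and a bottom strand cross each other pairwise, in crossings
`a` (top over middle), `b` (top over bottom) and `c` (middle over bottom), and bound a triangle.
The Booleans `t`, `m`, `l` tell whether the top strand passes `a` before `b`, the middle strand
`a` before `c`, and the lowest strand `b` before `c`. Three directed lines in the plane realise these
orders exactly if the signs of `a`, `b`, `c` are `k l`, `k m`, `k t` for a common sign `k`. The
move reverses all three orders. The two constructors correspond to the two cyclic orders in which
the knot can run through the three strands. -/
inductive Move : List Pass → List Pass → Prop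
  | rotate (u v : List Pass) : Move (u ++ v) (v ++ u)
  | relabel (f : Equiv.Perm ℕ) (w : List Pass) : Move w (w.map (Pass.relabel f))
  | reverse (w : List Pass) : Move w w.reverse
  | r1 (x : Pass) (w : List Pass) : Move w (x :: x.other :: w)
  | r2_direct (x y : Pass) (u v : List Pass) (ho : x.isOver = y.isOver)
      (hs : x.isPositive ≠ y.isPositive) :
      Move (u ++ v) ([x, y] ++ u ++ [x.other, y.other] ++ v)
  | r2_opposite (x y : Pass) (u v : List Pass) (ho : x.isOver = y.isOver)
      (hs : x.isPositive ≠ y.isPositive) :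
      Move (u ++ v) ([x, y] ++ u ++ [y.other, x.other] ++ v)
  | r3_tml (a b c : ℕ) (t m l k : Bool) (u v w : List Pass) :
      Move
        (pairInOrder t ⟨a, true, k == l⟩ ⟨b, true, k == m⟩ ++ u ++
          pairInOrder m ⟨a, false, k == l⟩ ⟨c, true, k == t⟩ ++ v ++
          pairInOrder l ⟨b, false, k == m⟩ ⟨c, false, k == t⟩ ++ w)
        (pairInOrder (!t) ⟨a, true, k == l⟩ ⟨b, true, k == m⟩ ++ u ++
          pairInOrder (!m) ⟨a, false, k == l⟩ ⟨c, true, k == t⟩ ++ v ++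
          pairInOrder (!l) ⟨b, false, k == m⟩ ⟨c, false, k == t⟩ ++ w)
  | r3_tlm (a b c : ℕ) (t m l k : Bool) (u v w : List Pass) :
      Move
        (pairInOrder t ⟨a, true, k == l⟩ ⟨b, true, k == m⟩ ++ u ++
          pairInOrder l ⟨b, false, k == m⟩ ⟨c, false, k == t⟩ ++ v ++
          pairInOrder m ⟨a, false, k == l⟩ ⟨c, true, k == t⟩ ++ w)
        (pairInOrder (!t) ⟨a, true, k == l⟩ ⟨b, true, k == m⟩ ++ u ++
          pairInOrder (!l) ⟨b, false, k == m⟩ ⟨c, false, k == t⟩ ++ v ++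
          pairInOrder (!m) ⟨a, false, k == l⟩ ⟨c, true, k == t⟩ ++ w)

/-- (Unoriented) knots: knot diagrams up to the equivalence relation generated by the moves. -/
def Knot : Type := Quot fun D D' : KnotDiagram => Move D.word D'.word

/-- `D` is a diagram of the knot `K` (with an arbitrary orientation). -/
def KnotDiagram.IsDiagramOf (D : KnotDiagram) (K : Knot) : Prop := Quot.mk _ D = K

/-! ### Dehn colorings -/

/-- A Dehn `p`-coloring. At each crossing let `x₁`, `x₃` be the two regions beside the incoming
over-semiarc and `x₂`, `x₄` those beside the outgoing over-semiarc, where `x₁` and `x₂` lie to the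
left; thus `x₂` is adjacent to `x₁` by an under-arc and `x₃` is adjacent to `x₁` by the over-arc. -/
structure DehnColoring (p : ℕ) (D : KnotDiagram) where
  color : Region D.word → ZMod p
  crossing_condition : ∀ j i, IsCrossing D.word j i →
    color (region j.castSucc .left) + color (region j.castSucc .right) =
      color (region j.succ .left) + color (region j.succ .right)

namespace DehnColoring

variable {p : ℕ} {D : KnotDiagram}

/-- The coloring is trivial at the crossing with over-pass `j`: `C(x₁) = C(x₄)`, `C(x₃) = C(x₂)`. -/
def TrivialAt (C : DehnColoring p D) (j : Fin D.word.length) : Prop :=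
  C.color (region j.castSucc .left) = C.color (region j.succ .right) ∧
    C.color (region j.castSucc .right) = C.color (region j.succ .left)

/-- A Dehn coloring is nontrivial if some crossing is nontrivially colored. -/
def Nontrivial (C : DehnColoring p D) : Prop :=
  ∃ j i, IsCrossing D.word j i ∧ ¬ C.TrivialAt j

/-- The set of colors used by a Dehn coloring. -/
def colors (C : DehnColoring p D) : Set (ZMod p) := Set.range C.color

end DehnColoring

namespace Knot

/-- `K` has a diagram with a nontrivial Dehn `p`-coloring. -/
def DehnColorable (p : ℕ) (K : Knot) : Prop :=
  ∃ D : KnotDiagram, D.IsDiagramOf K ∧ ∃ C : DehnColoring p D, C.Nontrivial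

/-- The minimum number of colors of nontrivially Dehn `p`-colored diagrams of `K`. -/
noncomputable def mincol (p : ℕ) (K : Knot) : ℕ :=
  sInf {n | ∃ D : KnotDiagram, D.IsDiagramOf K ∧
    ∃ C : DehnColoring p D, C.Nontrivial ∧ C.colors.ncard = n}

end Knot

/-! ### Shadow quandle colorings and cocycle invariants

The quandle operation `x * y` of the knot-theoretic literature is `Shelf.act y x`. The normal vector
of a semiarc points to its left. -/

/-- At the crossing with under-pass `i`, the under-semiarc from which the normal vector of the
over-strand points. -/
def sourceUnder {w : List Pass} (i : Fin w.length) : Semiarc w :=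
  if (w.get i).isPositive then i.castSucc else i.succ

/-- At the crossing with under-pass `i`, the under-semiarc to which the normal vector of the
over-strand points. -/
def targetUnder {w : List Pass} (i : Fin w.length) : Semiarc w :=
  if (w.get i).isPositive then i.succ else i.castSucc

/-- A shadow coloring of an oriented diagram by a quandle `Q`: the arcs and the regions are colored
by elements of `Q`. An over-strand keeps its color, and whoever crosses an arc colored `y` in the
direction of its normal vector, changes its color from `x` to `x * y`. -/
@[ext] structure ShadowColoring (Q : Type) [Quandle Q] (D : KnotDiagram) where
  arc : Semiarc D.word → Q
  reg : Region D.word → Q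
  arc_cut : arc (Fin.last _) = arc 0
  arc_over : ∀ j i, IsCrossing D.word j i → arc j.castSucc = arc j.succ
  arc_under : ∀ j i, IsCrossing D.word j i →
    arc (targetUnder i) = Shelf.act (arc j.castSucc) (arc (sourceUnder i))
  reg_semiarc : ∀ u : Semiarc D.word,
    reg (region u .left) = Shelf.act (arc u) (reg (region u .right))

theorem Region.finite (w : List Pass) : Finite (Region w) :=
  have : Finite Side :=
    Finite.of_injective (fun s : Side => match s with | .left => true | .right => false)
      (by rintro (_ | _) (_ | _) h <;> simp_all)
  inferInstanceAs (Finite (Quot _))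

namespace ShadowColoring

variable {Q : Type} [Quandle Q] {D : KnotDiagram}

theorem finite [Finite Q] : Finite (ShadowColoring Q D) :=
  have := Region.finite D.word
  Finite.of_injective (fun S : ShadowColoring Q D => (S.arc, S.reg)) fun S T h => by
    simp only [Prod.mk.injEq] at h
    exact ShadowColoring.ext h.1 h.2

/-- A shadow coloring is nontrivial if its arcs are not all of the same color. -/
def Nontrivial (S : ShadowColoring Q D) : Prop := ∃ u v, S.arc u ≠ S.arc v

/-- The sum over all crossings of `ε θ(x, y, z)`, where `ε` is the sign of the crossing, `x` the
color of the region from which both normal vectors point, `y` the color of the under-arc from which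
the normal vector of the over-arc points, and `z` the color of the over-arc. -/
noncomputable def weight {A : Type} [AddCommGroup A] (θ : Q → Q → Q → A)
    (S : ShadowColoring Q D) : A :=
  open scoped Classical in
  ∑ j : Fin D.word.length, ∑ i : Fin D.word.length,
    if IsCrossing D.word j i then
      (if (D.word.get j).isPositive then (1 : ℤ) else -1) •
        θ (S.reg (region (sourceUnder i) .right)) (S.arc (sourceUnder i)) (S.arc j.castSucc)
    else 0

end ShadowColoring

/-- The multiset of the weights of all nontrivial shadow colorings of `D`. -/
noncomputable def shadowCocycleInvariantNT {Q : Type} [Quandle Q] [Finite Q]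
    {A : Type} [AddCommGroup A] (θ : Q → Q → Q → A) (D : KnotDiagram) : Multiset A :=
  open scoped Classical in
  letI : Fintype (ShadowColoring Q D) := @Fintype.ofFinite _ ShadowColoring.finite
  ((Finset.univ : Finset (ShadowColoring Q D)).filter ShadowColoring.Nontrivial).val.map
    (ShadowColoring.weight θ)

instance (p : ℕ) [NeZero p] : Finite (Quandle.Dihedral p) := inferInstanceAs (Finite (ZMod p))

/-- Mochizuki's 3-cocycle
`θ(x, y, z) = (x - y) ((2 z - y) ^ p + y ^ p - 2 z ^ p) / p` of the dihedral quandle of order `p`.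
The fraction is evaluated on integer representatives; its numerator is divisible by `p` if `p` is
prime, and modulo `p` the result does not depend on the representatives. -/
def mochizuki (p : ℕ) (x y z : Quandle.Dihedral p) : ZMod p :=
  let x' : ZMod p := x
  let y' : ZMod p := y
  let z' : ZMod p := z
  (x' - y') * (((2 * (z'.val : ℤ) - y'.val) ^ p + (y'.val : ℤ) ^ p - 2 * (z'.val : ℤ) ^ p) / p : ℤ)

/-! The proof uses a weight of Dehn colorings that refers to colors of regions only. Fix a map `h`
that chooses an integer in each residue class. At a crossing, `h x₁ + h x₃ - h x₂ - h x₄` is `p`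
times an integer, the defect, and the crossing contributes `(x₁ - x₄)` times its defect. Two facts
about this weight give the theorem.

The first fact is that the existence of a nontrivial Dehn coloring of weight zero (`HasZero`) does
not depend on the diagram, and that it puts `0` into the shadow cocycle invariant. A kink is always
trivially colored, and the two crossings of a bigon cancel. In a move of type III the colors sit at
the vertices of a cube: each crossing is a face, the move replaces it by the opposite face, and the
signed sum of the six contributions vanishes. Only the creation of a bigon needs planarity: the sums
of the two colors beside each semiarc extend without difficulty, and a dimension count based on the
Euler characteristic shows that such sums come from colors of regions (`exists_region_colors`). For
the link with Mochizuki's cocycle, color each arc by half the sum of the colors on its two sides. A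
Dehn coloring thus becomes a shadow coloring with the same region colors. The fraction in the
cocycle is a second difference of `v ↦ v ^ p`, which by Fermat is itself a choice of integers in the
residue classes. Comparing it with `h` alters the contributions by differences of a potential that
telescope along the knot, so four times the shadow weight is minus the Dehn weight
(`sum_shadowWeight`).

The second fact is that few colors force weight zero. If on a set of colors the contribution of a
crossing is the sum of an antisymmetric function over the four sides of the crossing (`Tame`), the
total telescopes to zero. Tameness passes to subsets and is invariant under affine maps. It holds
for residues below `p / 2`, where no carry occurs and all defects vanish, and, if a system of
prescribed differences is solvable, also for such residues with one further residue
(`tame_of_star`). For each prime in question, a finite computation shows that affine maps bring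
every set of `⌊log₂ p⌋ + 2` residues into one of these two forms.

Hence a nontrivial coloring with at most `⌊log₂ p⌋ + 2` colors would produce a zero in the
invariant. -/

/-! ### Walks along a word -/

/-- `Walk i o w s t`: reading the word `w` leads from the state `s` to the state `t`, where the letter
`x` is read in the state `i x` and leads to the state `o x`. -/
def Walk {α S : Type*} (i o : α → S) : List α → S → S → Prop
  | [], s, t => s = t
  | x :: w, s, t => s = i x ∧ Walk i o w (o x) t

namespace Walk

variable {α S : Type*} {i o i' o' : α → S}

@[simp] theorem nil_iff {s t : S} : Walk i o [] s t ↔ s = t := Iff.rfl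

@[simp] theorem cons_iff {x : α} {w : List α} {s t : S} :
    Walk i o (x :: w) s t ↔ s = i x ∧ Walk i o w (o x) t := Iff.rfl

theorem append_iff {u v : List α} {s t : S} :
    Walk i o (u ++ v) s t ↔ ∃ m, Walk i o u s m ∧ Walk i o v m t := by
  induction u generalizing s with
  | nil => simp
  | cons x u ih => simp [ih, and_assoc]

theorem congr {w : List α} {s t : S} (h : ∀ x ∈ w, i x = i' x ∧ o x = o' x) :
    Walk i o w s t ↔ Walk i' o' w s t := by
  induction w generalizing s with
  | nil => simp
  | cons x w ih =>
    have hx := h x (by simp)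
    rw [cons_iff, cons_iff, hx.1, hx.2, ih fun y hy => h y (by simp [hy])]

theorem map_state {T : Type*} (g : S → T) {w : List α} {s t : S} (h : Walk i o w s t) :
    Walk (fun x => g (i x)) (fun x => g (o x)) w (g s) (g t) := by
  induction w generalizing s with
  | nil => simpa using congrArg g h
  | cons x w ih => exact ⟨congrArg g h.1, ih h.2⟩

theorem map_letter {β : Type*} (g : β → α) {w : List β} {s t : S} :
    Walk i o (w.map g) s t ↔ Walk (fun x => i (g x)) (fun x => o (g x)) w s t := by
  induction w generalizing s with
  | nil => simp
  | cons x w ih => simp [ih]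

theorem reverse {w : List α} {s t : S} (h : Walk i o w s t) : Walk o i w.reverse t s := by
  induction w generalizing s with
  | nil => exact Eq.symm h
  | cons x w ih =>
    rw [List.reverse_cons, append_iff]
    exact ⟨_, ih h.2, rfl, h.1.symm⟩

/-- An invariant of all letters is preserved along a walk. -/
theorem invariant (P : S → Prop) {w : List α} (hw : ∀ x ∈ w, P (i x) → P (o x)) {s t : S}
    (h : Walk i o w s t) (hs : P s) : P t ∧ ∀ x ∈ w, P (i x) := by
  induction w generalizing s with
  | nil => exact ⟨Eq.subst h hs, by simp⟩
  | cons x w ih =>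
    have hx : P (i x) := h.1 ▸ hs
    obtain ⟨h1, h2⟩ := ih (fun y hy => hw y (by simp [hy])) h.2 (hw x (by simp) hx)
    refine ⟨h1, ?_⟩
    simpa [hx] using h2

/-- The sum telescopes; along a closed walk it vanishes. Every cancellation over a whole diagram is
an instance of this. -/
theorem sum_sub {A : Type*} [AddCommGroup A] (F : S → A) {w : List α} {s t : S}
    (h : Walk i o w s t) : (w.map fun x => F (o x) - F (i x)).sum = F t - F s := by
  induction w generalizing s with
  | nil => simp [Eq.symm h]
  | cons x w ih => rw [List.map_cons, List.sum_cons, ih h.2, h.1]; abel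

/-- Together with `of_states` this translates between walks along a word, suited to cutting and
pasting words, and functions on semiarcs, suited to regions. -/
theorem exists_states {w : List α} {s t : S} (h : Walk i o w s t) :
    ∃ σ : Fin (w.length + 1) → S, σ 0 = s ∧ σ (Fin.last _) = t ∧
      ∀ k, σ k.castSucc = i (w.get k) ∧ σ k.succ = o (w.get k) := by
  induction w generalizing s with
  | nil => exact ⟨fun _ => s, rfl, h, fun k => k.elim0⟩
  | cons x w ih =>
    obtain ⟨σ, h0, hl, hσ⟩ := ih h.2
    refine ⟨Fin.cons s σ, rfl, ?_, ?_⟩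
    · exact hl
    · intro k
      refine Fin.cases ⟨h.1, ?_⟩ (fun k => ?_) k
      · exact h0
      · exact hσ k

theorem of_states {w : List α} (σ : Fin (w.length + 1) → S)
    (hσ : ∀ k, σ k.castSucc = i (w.get k) ∧ σ k.succ = o (w.get k)) :
    Walk i o w (σ 0) (σ (Fin.last _)) := by
  induction w with
  | nil => rfl
  | cons x w ih =>
    refine ⟨(hσ 0).1, ?_⟩
    have := ih (fun k => σ k.succ) fun k => hσ k.succ
    rw [show σ (Fin.succ 0) = o x from (hσ 0).2] at this
    exact this

end Walk

/-! ### Gauss codes -/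

namespace Pass

@[simp] theorem other_other (x : Pass) : x.other.other = x := by simp [other]
@[simp] theorem other_crossing (x : Pass) : x.other.crossing = x.crossing := rfl
@[simp] theorem other_isOver (x : Pass) : x.other.isOver = !x.isOver := rfl
@[simp] theorem other_isPositive (x : Pass) : x.other.isPositive = x.isPositive := rfl

end Pass

namespace IsGaussCode

variable {w : List Pass}

theorem nodup (hw : IsGaussCode w) : w.Nodup := hw.1.of_map _

theorem eq_of_crossing (hw : IsGaussCode w) {x y : Pass} (hx : x ∈ w) (hy : y ∈ w)
    (hc : x.crossing = y.crossing) (ho : x.isOver = y.isOver) : x = y :=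
  List.inj_on_of_nodup_map hw.1 hx hy (by simp [hc, ho])

/-- `Pass.other` is an involution that exchanges the over-passes and the under-passes of the word.
-/
theorem perm (hw : IsGaussCode w) :
    w.Perm (w.filter (·.isOver) ++ (w.filter (·.isOver)).map Pass.other) := by
  have h1 := (List.filter_append_perm (fun x : Pass => x.isOver) w).symm
  refine h1.trans (List.Perm.append_left _ ?_)
  rw [List.perm_ext_iff_of_nodup (hw.nodup.filter _)
    ((hw.nodup.filter _).map fun x y h => by simpa using congrArg Pass.other h)]
  intro x
  simp only [List.mem_filter, List.mem_map, Bool.not_eq_true']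
  constructor
  · rintro ⟨hx, ho⟩
    exact ⟨x.other, ⟨hw.2 x hx, by simpa using ho⟩, by simp⟩
  · rintro ⟨y, ⟨hy, ho⟩, rfl⟩
    exact ⟨hw.2 y hy, by simpa using ho⟩

/-- The sum over all passes is the sum over all crossings of the contributions of both passes. -/
theorem sum_eq {A : Type*} [AddCommMonoid A] (hw : IsGaussCode w) (g : Pass → A) :
    (w.map g).sum = ((w.filter (·.isOver)).map fun x => g x + g x.other).sum := by
  rw [(hw.perm.map g).sum_eq, List.map_append, List.sum_append, List.map_map, List.sum_map_add]
  rfl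

end IsGaussCode

/-! ### Colors at a crossing -/

/-- The colors of the four regions at a crossing: `x₁` and `x₃` lie to the left and to the right of
the incoming over-semiarc, `x₂` and `x₄` to the left and to the right of the outgoing one. -/
@[ext] structure Corners (R : Type*) where
  x₁ : R
  x₂ : R
  x₃ : R
  x₄ : R

namespace Corners

variable {R : Type*}

/-- The colors to the left and to the right of a pass when it enters the crossing. -/
def entry (q : Corners R) (x : Pass) : R × R :=
  if x.isOver then (q.x₁, q.x₃) else if x.isPositive then (q.x₃, q.x₄) else (q.x₂, q.x₁)

/-- The colors to the left and to the right of a pass when it leaves the crossing. -/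
def exit (q : Corners R) (x : Pass) : R × R :=
  if x.isOver then (q.x₂, q.x₄) else if x.isPositive then (q.x₁, q.x₂) else (q.x₄, q.x₃)

/-- The Dehn condition. -/
def Balanced [Add R] (q : Corners R) : Prop := q.x₁ + q.x₃ = q.x₂ + q.x₄

/-- The crossing is trivially colored. -/
def Trivial (q : Corners R) : Prop := q.x₁ = q.x₄ ∧ q.x₃ = q.x₂

/-- The colors after a change of the orientation. -/
def rev (q : Corners R) : Corners R := ⟨q.x₄, q.x₃, q.x₂, q.x₁⟩

end Corners

/-- A closed walk through corner colors. -/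
def ColorWalk {R : Type*} (f : ℕ → Corners R) : List Pass → R × R → R × R → Prop :=
  Walk (fun x => (f x.crossing).entry x) (fun x => (f x.crossing).exit x)

/-! ### The weight of a Dehn coloring relative to a choice of integer representatives -/

section Weight

variable {p : ℕ}

/-- A map which chooses an integer in each residue class. -/
def IsLift (h : ZMod p → ℤ) : Prop := ∀ a, (h a : ZMod p) = a

/-- The failure of the Dehn condition for the integers over the corner colors, divided by `p`. -/
def Corners.defect (h : ZMod p → ℤ) (q : Corners (ZMod p)) : ℤ :=
  (h q.x₁ + h q.x₃ - h q.x₂ - h q.x₄) / p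

/-- The Dehn condition makes the numerator divisible by `p`, so the quotient is exact. Identities
between defects are therefore proved by multiplying with `p` and comparing sums of values of `h`. -/
theorem Corners.mul_defect {h : ZMod p → ℤ} (hh : IsLift h) {q : Corners (ZMod p)}
    (hq : q.Balanced) : (p : ℤ) * q.defect h = h q.x₁ + h q.x₃ - h q.x₂ - h q.x₄ := by
  refine Int.mul_ediv_cancel' ((ZMod.intCast_zmod_eq_zero_iff_dvd _ p).1 ?_)
  push_cast
  rw [hh, hh, hh, hh]
  have hq' : q.x₁ + q.x₃ = q.x₂ + q.x₄ := hq
  linear_combination hq'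

/-- The contribution of a crossing to the weight. -/
def Corners.weight (h : ZMod p → ℤ) (q : Corners (ZMod p)) : ZMod p := (q.x₁ - q.x₄) * q.defect h

/-- The weight of corner colors on a word. -/
def wordWeight (h : ZMod p → ℤ) (f : ℕ → Corners (ZMod p)) (w : List Pass) : ZMod p :=
  (w.map fun x => if x.isOver then (f x.crossing).weight h else 0).sum

/-- The word has a nontrivial Dehn coloring of weight zero. -/
def HasZero (h : ZMod p → ℤ) (w : List Pass) : Prop :=
  ∃ f : ℕ → Corners (ZMod p), (∀ n, (f n).Balanced) ∧ (∃ s, ColorWalk f w s s) ∧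
    (∃ x ∈ w, ¬ (f x.crossing).Trivial) ∧ wordWeight h f w = 0

theorem wordWeight_append (h : ZMod p → ℤ) (f : ℕ → Corners (ZMod p)) (u v : List Pass) :
    wordWeight h f (u ++ v) = wordWeight h f u + wordWeight h f v := by
  simp [wordWeight]

theorem wordWeight_congr (h : ZMod p → ℤ) {f g : ℕ → Corners (ZMod p)} {w : List Pass}
    (hfg : ∀ x ∈ w, f x.crossing = g x.crossing) : wordWeight h f w = wordWeight h g w := by
  unfold wordWeight
  congr 1
  exact List.map_congr_left fun x hx => by rw [hfg x hx]

theorem colorWalk_congr {R : Type*} {f g : ℕ → Corners R} {w : List Pass}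
    (hfg : ∀ x ∈ w, f x.crossing = g x.crossing) {s t : R × R} :
    ColorWalk f w s t ↔ ColorWalk g w s t :=
  Walk.congr fun x hx => by simp [hfg x hx]

theorem wordWeight_eq (h : ZMod p → ℤ) (f : ℕ → Corners (ZMod p)) (w : List Pass) :
    wordWeight h f w = ((w.filter (·.isOver)).map fun x => (f x.crossing).weight h).sum := by
  unfold wordWeight
  induction w with
  | nil => simp
  | cons x w ih => cases hx : x.isOver <;> simp [hx, ih]

theorem wordWeight_perm (h : ZMod p → ℤ) (f : ℕ → Corners (ZMod p)) {w w' : List Pass}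
    (hw : w.Perm w') : wordWeight h f w = wordWeight h f w' :=
  (hw.map _).sum_eq

end Weight


/-! ### Invariance under the elementary changes that need no planarity -/

namespace Corners

variable {R : Type*}

theorem Balanced.rev [AddCommMonoid R] {q : Corners R} (hq : q.Balanced) : q.rev.Balanced := by
  unfold Balanced at *
  simp only [Corners.rev]
  rw [add_comm, add_comm q.x₃, hq]

theorem rev_trivial {q : Corners R} : q.rev.Trivial ↔ q.Trivial := by
  unfold Trivial Corners.rev
  constructor <;> rintro ⟨h1, h2⟩ <;> exact ⟨h1.symm, h2.symm⟩

theorem rev_entry (q : Corners R) (x : Pass) : q.rev.entry x = (q.exit x).swap := by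
  unfold entry exit rev
  split_ifs <;> rfl

theorem rev_exit (q : Corners R) (x : Pass) : q.rev.exit x = (q.entry x).swap := by
  unfold entry exit rev
  split_ifs <;> rfl

/-- The sum of the colors beside a strand does not change at a trivially colored crossing. -/
theorem Trivial.sum_exit [AddCommMonoid R] {q : Corners R} (hq : q.Trivial) (x : Pass) :
    (q.exit x).1 + (q.exit x).2 = (q.entry x).1 + (q.entry x).2 := by
  obtain ⟨h1, h2⟩ := hq
  unfold entry exit
  split_ifs <;> simp [h1, h2, add_comm]

variable {p : ℕ}

/-- Reversal changes the sign of both factors, `x₁ - x₄` and the defect. -/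
theorem rev_weight (h : ZMod p → ℤ) (q : Corners (ZMod p)) (hp : p ≠ 0) (hh : IsLift h)
    (hq : q.Balanced) : q.rev.weight h = q.weight h := by
  have h1 := mul_defect hh hq
  have h2 := mul_defect hh hq.rev
  have h3 : q.rev.defect h = - q.defect h := by
    have hp' : (p : ℤ) ≠ 0 := by exact_mod_cast hp
    apply mul_left_cancel₀ hp'
    rw [h2, mul_neg, h1]
    simp only [rev]
    ring
  unfold weight
  rw [h3]
  simp only [rev]
  push_cast
  ring

end Corners

variable {p : ℕ} {h : ZMod p → ℤ}

theorem HasZero.rotate {u v : List Pass} (H : HasZero h (u ++ v)) : HasZero h (v ++ u) := by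
  obtain ⟨f, hf, ⟨s, hs⟩, ⟨x, hx, hx'⟩, h0⟩ := H
  obtain ⟨m, h1, h2⟩ := Walk.append_iff.1 hs
  refine ⟨f, hf, ⟨m, Walk.append_iff.2 ⟨s, h2, h1⟩⟩, ⟨x, ?_, hx'⟩, ?_⟩
  · simpa [or_comm] using hx
  · rwa [wordWeight_perm h f List.perm_append_comm] at h0

theorem hasZero_relabel (e : Equiv.Perm ℕ) (w : List Pass) :
    HasZero h (w.map (Pass.relabel e)) ↔ HasZero h w := by
  constructor
  · rintro ⟨f, hf, ⟨s, hs⟩, ⟨x, hx, hx'⟩, h0⟩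
    obtain ⟨y, hy, rfl⟩ := List.mem_map.1 hx
    refine ⟨fun n => f (e n), fun n => hf _, ⟨s, Walk.map_letter _ |>.1 hs⟩, ⟨y, hy, hx'⟩, ?_⟩
    rw [wordWeight, List.map_map] at h0
    exact h0
  · rintro ⟨f, hf, ⟨s, hs⟩, ⟨x, hx, hx'⟩, h0⟩
    refine ⟨fun n => f (e.symm n), fun n => hf _, ⟨s, (Walk.map_letter _).2 ?_⟩,
      ⟨_, List.mem_map_of_mem hx, by simpa [Pass.relabel] using hx'⟩, ?_⟩
    · simpa [Pass.relabel, Corners.entry, Corners.exit, ColorWalk] using hs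
    · simpa [wordWeight, Function.comp_def, Pass.relabel] using h0

theorem HasZero.reverse (hp : p ≠ 0) (hh : IsLift h) {w : List Pass} (H : HasZero h w) :
    HasZero h w.reverse := by
  obtain ⟨f, hf, ⟨s, hs⟩, ⟨x, hx, hx'⟩, h0⟩ := H
  refine ⟨fun n => (f n).rev, fun n => (hf n).rev, ⟨s.swap, ?_⟩,
    ⟨x, by simpa using hx, by rwa [Corners.rev_trivial]⟩, ?_⟩
  · have := hs.reverse.map_state Prod.swap
    simpa only [ColorWalk, Corners.rev_entry, Corners.rev_exit] using this
  · rw [wordWeight_perm h _ (List.reverse_perm w), ← h0]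
    simp only [wordWeight, Corners.rev_weight h _ hp hh (hf _)]

/-! ### The first Reidemeister move -/

theorem IsGaussCode.ne_crossing_of_append {w u v : List Pass} (hw : IsGaussCode w)
    {x : Pass} (h : w.Perm (u ++ v)) (hx : x ∈ u) (hx' : x.other ∈ u) :
    ∀ y ∈ v, y.crossing ≠ x.crossing := by
  intro y hy hc
  have hn : (u ++ v).Nodup := h.nodup_iff.1 hw.nodup
  rw [List.nodup_append] at hn
  by_cases ho : y.isOver = x.isOver
  · have := hw.eq_of_crossing (h.mem_iff.2 (by simp [hy])) (h.mem_iff.2 (by simp [hx])) hc ho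
    exact hn.2.2 _ hx _ hy this.symm
  · have := hw.eq_of_crossing (y := x.other) (h.mem_iff.2 (by simp [hy]))
      (h.mem_iff.2 (by simp [hx'])) hc (by simpa using Bool.eq_not_of_ne ho)
    exact hn.2.2 _ hx' _ hy this.symm

/-- The colors at a kink beside the given state. -/
def Corners.kink {R : Type*} (x : Pass) (s : R × R) : Corners R :=
  if x.isOver then ⟨s.1, s.2, s.2, s.1⟩ else ⟨s.2, s.1, s.1, s.2⟩

theorem Corners.kink_balanced {R : Type*} [AddCommMonoid R] (x : Pass) (s : R × R) :
    (Corners.kink x s).Balanced := by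
  unfold Corners.kink Corners.Balanced
  split_ifs <;> simp [add_comm]

theorem Corners.kink_trivial {R : Type*} (x : Pass) (s : R × R) :
    (Corners.kink x s).Trivial := by
  unfold Corners.kink Corners.Trivial
  split_ifs <;> simp

theorem Corners.kink_walk {R : Type*} (x : Pass) (s : R × R) :
    s = (kink x s).entry x ∧ (kink x s).exit x = (kink x s).entry x.other ∧
      (kink x s).exit x.other = s := by
  rcases x with ⟨c, _ | _, _ | _⟩ <;> simp [kink, entry, exit, Pass.other]

/-- The loop of the kink identifies two corners at the crossing, and the Dehn condition then
identifies the other two. -/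
theorem Corners.trivial_of_kink {R : Type*} [AddCommGroup R] {q : Corners R} (hq : q.Balanced)
    {x : Pass} (hx : q.exit x = q.entry x.other) : q.Trivial ∧ q.exit x.other = q.entry x := by
  unfold Balanced at hq
  rcases x with ⟨c, _ | _, _ | _⟩ <;>
  · simp only [entry, exit, Pass.other, Prod.ext_iff, Bool.not_true, Bool.not_false, if_true,
      Bool.false_eq_true, if_false] at hx
    obtain ⟨h1, h2⟩ := hx
    have h3 : q.x₁ = q.x₄ ∧ q.x₃ = q.x₂ := by
      constructor <;> grind
    refine ⟨h3, ?_⟩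
    simp [entry, exit, Pass.other, h3.1, h3.2]

theorem Corners.Trivial.weight_eq_zero {q : Corners (ZMod p)} (hq : q.Trivial) :
    q.weight h = 0 := by
  simp [weight, hq.1]

/-- The kink is trivially colored, so it affects neither the weight nor the nontriviality. -/
theorem hasZero_r1 {x : Pass} {w : List Pass} (hw : IsGaussCode (x :: x.other :: w)) :
    HasZero h (x :: x.other :: w) ↔ HasZero h w := by
  have key : ∀ f : ℕ → Corners (ZMod p), (f x.crossing).Trivial →
      wordWeight h f (x :: x.other :: w) = wordWeight h f w := by
    intro f hf
    simp [wordWeight, hf.weight_eq_zero]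
  constructor
  · rintro ⟨f, hf, ⟨s, hs⟩, ⟨y, hy, hy'⟩, h0⟩
    obtain ⟨h1, h2, h3⟩ := hs
    obtain ⟨h4, h5⟩ := Corners.trivial_of_kink (hf x.crossing) h2
    refine ⟨f, hf, ⟨s, ?_⟩, ⟨y, ?_, hy'⟩, (key f h4).symm.trans h0⟩
    · have h6 : (fun z : Pass => (f z.crossing).exit z) x.other = s := by
        rw [h1]; exact h5
      rw [h6] at h3
      exact h3
    · rcases List.mem_cons.1 hy with rfl | hy
      · exact absurd h4 hy'
      rcases List.mem_cons.1 hy with rfl | hy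
      · exact absurd h4 hy'
      exact hy
  · rintro ⟨f, hf, ⟨s, hs⟩, ⟨y, hy, hy'⟩, h0⟩
    have hne : ∀ y ∈ w, y.crossing ≠ x.crossing :=
      hw.ne_crossing_of_append (u := [x, x.other]) (List.Perm.refl _) (by simp) (by simp)
    -- The label of the kink does not occur in `w`, so its corners can be recolored freely.
    set g := Function.update f x.crossing (Corners.kink x s) with hg
    have hgx : g x.crossing = Corners.kink x s := Function.update_self ..
    have hfg : ∀ y ∈ w, f y.crossing = g y.crossing := fun y hy =>
      (Function.update_of_ne (hne y hy) _ _).symm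
    obtain ⟨k1, k2, k3⟩ := Corners.kink_walk x s
    refine ⟨g, fun n => ?_, ⟨s, ?_, ?_, ?_⟩, ⟨y, by simp [hy], by rwa [← hfg y hy]⟩, ?_⟩
    · by_cases hn : n = x.crossing
      · rw [hn, hgx]; exact Corners.kink_balanced x s
      · rw [hg, Function.update_of_ne hn]; exact hf n
    · change s = (g x.crossing).entry x
      rw [hgx]; exact k1
    · change (g x.crossing).exit x = (g x.crossing).entry x.other
      rw [hgx]; exact k2
    · change ColorWalk g w ((g x.crossing).exit x.other) s
      rw [hgx, k3]
      exact (colorWalk_congr hfg).1 hs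
    · rw [key g (by rw [hgx]; exact Corners.kink_trivial x s), ← wordWeight_congr h hfg, h0]

/-! ### The third Reidemeister move -/

/-- The colors at a crossing, given the color `g o u` of the corner on the given sides of the
over-strand and of the under-strand (`true` is left) and the sign of the crossing. -/
def Corners.ofSides {R : Type*} (σ : Bool) (g : Bool → Bool → R) : Corners R :=
  ⟨g true σ, g true !σ, g false σ, g false !σ⟩

/-- The color of the corner on the given sides of the two strands. -/
def Corners.side {R : Type*} (σ : Bool) (q : Corners R) (o u : Bool) : R :=
  if o then (if u = σ then q.x₁ else q.x₂) else (if u = σ then q.x₃ else q.x₄)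

theorem Corners.ofSides_balanced {R : Type*} [AddCommMonoid R] {σ : Bool} {g : Bool → Bool → R} :
    (ofSides σ g).Balanced ↔ g true true + g false true = g true false + g false false := by
  cases σ
  · exact eq_comm
  · exact Iff.rfl

theorem Corners.ofSides_trivial {R : Type*} {σ : Bool} {g : Bool → Bool → R} :
    (ofSides σ g).Trivial ↔ g true true = g false false ∧ g false true = g true false := by
  cases σ
  · unfold Trivial ofSides
    constructor <;> rintro ⟨h1, h2⟩ <;> exact ⟨h2.symm, h1.symm⟩
  · exact Iff.rfl

/-- Sides of the top, middle and bottom strand are the coordinates of a vertex of a cube, and `g`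
colors the vertices. The three crossings are faces with a common vertex, the triangle; they contain
seven vertices. The eighth, opposite vertex is the triangle after the move, and its color is chosen
so that the Dehn condition holds on all six faces. -/
theorem r3_colors {R : Type*} [CommRing R] (f : ℕ → Corners R) (hf : ∀ n, (f n).Balanced)
    (a b c : ℕ) (t m l k : Bool) {s₁ s₂ s₃ t₁ t₂ t₃ : R × R}
    (hT : ColorWalk f (pairInOrder t ⟨a, true, k == l⟩ ⟨b, true, k == m⟩) s₁ t₁)
    (hM : ColorWalk f (pairInOrder m ⟨a, false, k == l⟩ ⟨c, true, k == t⟩) s₂ t₂)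
    (hL : ColorWalk f (pairInOrder l ⟨b, false, k == m⟩ ⟨c, false, k == t⟩) s₃ t₃) :
    ∃ g : Bool → Bool → Bool → R,
      f a = Corners.ofSides (k == l) (fun T M => g T M (t == (k == m))) ∧
      f b = Corners.ofSides (k == m) (fun T L => g T (!(t == (k == l))) L) ∧
      f c = Corners.ofSides (k == t) (fun M L => g (m == (k == l)) M L) ∧
      (∀ L, g true true L + g false true L = g true false L + g false false L) ∧
      (∀ M, g true M true + g false M true = g true M false + g false M false) ∧
      (∀ T, g T true true + g T false true = g T true false + g T false false) := by
  have ha := hf a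
  have hb := hf b
  have hc := hf c
  unfold Corners.Balanced at ha hb hc
  -- The first three branches read off the corners of the existing crossings; the last is the
  -- missing vertex, whose color is dictated by the Dehn condition at `a` after the move.
  refine ⟨fun T M L =>
    if L = (t == (k == m)) then (f a).side (k == l) T M
    else if M = !(t == (k == l)) then (f b).side (k == m) T L
    else if T = (m == (k == l)) then (f c).side (k == t) M L
    else (f b).side (k == m) true L + (f b).side (k == m) false L -
      (f c).side (k == t) M L, ?_⟩
  cases t <;> cases m <;> cases l <;> cases k <;>
  · simp [ColorWalk, pairInOrder, Corners.entry, Corners.exit, Prod.ext_iff] at hT hM hL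
    simp [Corners.ofSides, Corners.side, Corners.ext_iff]
    grind

/-- After the move each crossing occupies the opposite face of the cube. The outer ends of the three
strands lie between the same pairs of vertices as before, so the states there do not change. -/
theorem r3_walks {R : Type*} (g : Bool → Bool → Bool → R) (f f' : ℕ → Corners R)
    (a b c : ℕ) (t m l k : Bool) {s₁ s₂ s₃ t₁ t₂ t₃ : R × R}
    (ha : f a = Corners.ofSides (k == l) (fun T M => g T M (t == (k == m))))
    (hb : f b = Corners.ofSides (k == m) (fun T L => g T (!(t == (k == l))) L))
    (hc : f c = Corners.ofSides (k == t) (fun M L => g (m == (k == l)) M L))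
    (ha' : f' a = Corners.ofSides (k == l) (fun T M => g T M (!(t == (k == m)))))
    (hb' : f' b = Corners.ofSides (k == m) (fun T L => g T (t == (k == l)) L))
    (hc' : f' c = Corners.ofSides (k == t) (fun M L => g (!(m == (k == l))) M L))
    (hT : ColorWalk f (pairInOrder t ⟨a, true, k == l⟩ ⟨b, true, k == m⟩) s₁ t₁)
    (hM : ColorWalk f (pairInOrder m ⟨a, false, k == l⟩ ⟨c, true, k == t⟩) s₂ t₂)
    (hL : ColorWalk f (pairInOrder l ⟨b, false, k == m⟩ ⟨c, false, k == t⟩) s₃ t₃) :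
    ColorWalk f' (pairInOrder (!t) ⟨a, true, k == l⟩ ⟨b, true, k == m⟩) s₁ t₁ ∧
    ColorWalk f' (pairInOrder (!m) ⟨a, false, k == l⟩ ⟨c, true, k == t⟩) s₂ t₂ ∧
    ColorWalk f' (pairInOrder (!l) ⟨b, false, k == m⟩ ⟨c, false, k == t⟩) s₃ t₃ := by
  cases t <;> cases m <;> cases l <;> cases k <;>
  · simp [ColorWalk, pairInOrder, Corners.entry, Corners.exit, ha, hb, hc,
      Corners.ofSides] at hT hM hL
    simp [ColorWalk, pairInOrder, Corners.entry, Corners.exit, ha', hb', hc',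
      Corners.ofSides, hT, hM, hL]
    try grind


variable {p : ℕ} {h : ZMod p → ℤ}

/-- The contribution of a positive crossing, as a function of the sides. -/
theorem Corners.weight_ofSides (hp : p ≠ 0) (hh : IsLift h) (σ : Bool)
    {g : Bool → Bool → ZMod p} (hg : g true true + g false true = g true false + g false false) :
    (ofSides σ g).weight h = (if σ then 1 else -1) * (ofSides true g).weight h := by
  cases σ
  · have h1 := mul_defect hh (ofSides_balanced (σ := true).2 hg)
    have h2 := mul_defect hh (ofSides_balanced (σ := false).2 hg)
    have h3 : (ofSides false g).defect h = - (ofSides true g).defect h := by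
      apply mul_left_cancel₀ (show (p : ℤ) ≠ 0 by exact_mod_cast hp)
      rw [h2, mul_neg, h1]
      simp only [ofSides, Bool.not_true, Bool.not_false]
      ring
    unfold weight
    rw [h3]
    generalize (ofSides true g).defect h = d
    simp only [ofSides, Bool.not_true, Bool.not_false]
    push_cast
    linear_combination (d : ZMod p) * hg
  · simp

/-- The defects of the six faces are signed sums of `h` over vertices of the cube. Combining
opposite faces gives two linear relations between them, and with the Dehn conditions on the faces
these imply the identity. -/
theorem r3_weight_aux (hp : p ≠ 0) (hh : IsLift h) (g : Bool → Bool → Bool → ZMod p)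
    (hA : ∀ L, g true true L + g false true L = g true false L + g false false L)
    (hB : ∀ M, g true M true + g false M true = g true M false + g false M false)
    (hC : ∀ T, g T true true + g T false true = g T true false + g T false false) :
    ((Corners.ofSides true fun T M => g T M true).weight h -
      (Corners.ofSides true fun T M => g T M false).weight h) -
    ((Corners.ofSides true fun T L => g T true L).weight h -
      (Corners.ofSides true fun T L => g T false L).weight h) +
    ((Corners.ofSides true fun M L => g true M L).weight h -
      (Corners.ofSides true fun M L => g false M L).weight h) = 0 := by
  have mA := fun L => Corners.mul_defect hh (Corners.ofSides_balanced (σ := true)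
    (g := fun T M => g T M L).2 (hA L))
  have mB := fun M => Corners.mul_defect hh (Corners.ofSides_balanced (σ := true)
    (g := fun T L => g T M L).2 (hB M))
  have mC := fun T => Corners.mul_defect hh (Corners.ofSides_balanced (σ := true)
    (g := fun M L => g T M L).2 (hC T))
  set dA := fun L => (Corners.ofSides true fun T M => g T M L).defect h with hdA
  set dB := fun M => (Corners.ofSides true fun T L => g T M L).defect h with hdB
  set dC := fun T => (Corners.ofSides true fun M L => g T M L).defect h with hdC
  have hp' : (p : ℤ) ≠ 0 := by exact_mod_cast hp
  -- Times `p`, both sides are the sum of `h` over all vertices, with the product of the signs for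
  -- the middle and the bottom strand. In `e2` only the sign for the bottom strand occurs.
  have e1 : dA true - dA false = dB true - dB false := by
    apply mul_left_cancel₀ hp'
    rw [mul_sub, mul_sub]
    simp only [hdA, hdB]
    rw [mA, mA, mB, mB]
    simp only [Corners.ofSides, Bool.not_true]
    ring
  have e2 : dB true + dB false = dC true + dC false := by
    apply mul_left_cancel₀ hp'
    rw [mul_add, mul_add]
    simp only [hdC, hdB]
    rw [mC, mC, mB, mB]
    simp only [Corners.ofSides, Bool.not_true]
    ring
  have e1' : (dA true : ZMod p) - dA false = dB true - dB false := by exact_mod_cast congrArg (Int.cast (R := ZMod p)) e1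
  have e2' : (dB true : ZMod p) + dB false = dC true + dC false := by exact_mod_cast congrArg (Int.cast (R := ZMod p)) e2
  simp only [Corners.weight]
  change ((g true true true - g false false true) * (dA true : ZMod p) -
    (g true true false - g false false false) * (dA false : ZMod p)) -
    ((g true true true - g false true false) * (dB true : ZMod p) -
    (g true false true - g false false false) * (dB false : ZMod p)) +
    ((g true true true - g true false false) * (dC true : ZMod p) -
    (g false true true - g false false false) * (dC false : ZMod p)) = 0
  have a1 := hA true
  have a2 := hA false
  have b1 := hB true
  have b2 := hB false
  have c1 := hC true
  have c2 := hC false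
  grind

theorem r3_weight (hp : p ≠ 0) (hh : IsLift h) (g : Bool → Bool → Bool → ZMod p)
    (hA : ∀ L, g true true L + g false true L = g true false L + g false false L)
    (hB : ∀ M, g true M true + g false M true = g true M false + g false M false)
    (hC : ∀ T, g T true true + g T false true = g T true false + g T false false)
    (t m l k : Bool) :
    (Corners.ofSides (k == l) (fun T M => g T M (!(t == (k == m))))).weight h +
      (Corners.ofSides (k == m) (fun T L => g T (t == (k == l)) L)).weight h +
      (Corners.ofSides (k == t) (fun M L => g (!(m == (k == l))) M L)).weight h =
    (Corners.ofSides (k == l) (fun T M => g T M (t == (k == m)))).weight h +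
      (Corners.ofSides (k == m) (fun T L => g T (!(t == (k == l))) L)).weight h +
      (Corners.ofSides (k == t) (fun M L => g (m == (k == l)) M L)).weight h := by
  have key := r3_weight_aux hp hh g hA hB hC
  have wA := fun σ L => Corners.weight_ofSides hp hh σ (g := fun T M => g T M L) (hA L)
  have wB := fun σ M => Corners.weight_ofSides hp hh σ (g := fun T L => g T M L) (hB M)
  have wC := fun σ T => Corners.weight_ofSides hp hh σ (g := fun M L => g T M L) (hC T)
  rw [wA (k == l) (!(t == (k == m))), wA (k == l) (t == (k == m)), wB (k == m) (!(t == (k == l))),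
    wB (k == m) (t == (k == l)), wC (k == t) (!(m == (k == l))), wC (k == t) (m == (k == l))]
  cases t <;> cases m <;> cases l <;> cases k <;>
  · simp only [show (true == true) = true from rfl, show (true == false) = false from rfl,
      show (false == true) = false from rfl, show (false == false) = true from rfl,
      Bool.not_true, Bool.not_false, if_true,
      Bool.false_eq_true, if_false]
    first | linear_combination key | linear_combination -key

/-- This is the local content of the move, independent of the cyclic order in which the knot runs
through the three strands: new colors at three labels, the same states at the ends, the same total
contribution. Triviality needs only one direction, which by contraposition carries nontriviality
over to the new coloring. -/
theorem r3_core (hp : p ≠ 0) (hh : IsLift h) (f : ℕ → Corners (ZMod p))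
    (hf : ∀ n, (f n).Balanced) {a b c : ℕ} (hab : a ≠ b) (hac : a ≠ c) (hbc : b ≠ c)
    (t m l k : Bool) {σa σb σc : Bool} (hσa : σa = (k == l)) (hσb : σb = (k == m))
    (hσc : σc = (k == t)) {s₁ s₂ s₃ t₁ t₂ t₃ : ZMod p × ZMod p}
    (hT : ColorWalk f (pairInOrder t ⟨a, true, σa⟩ ⟨b, true, σb⟩) s₁ t₁)
    (hM : ColorWalk f (pairInOrder m ⟨a, false, σa⟩ ⟨c, true, σc⟩) s₂ t₂)
    (hL : ColorWalk f (pairInOrder l ⟨b, false, σb⟩ ⟨c, false, σc⟩) s₃ t₃) :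
    ∃ f' : ℕ → Corners (ZMod p), (∀ n, (f' n).Balanced) ∧
      (∀ n, n ≠ a → n ≠ b → n ≠ c → f n = f' n) ∧
      ColorWalk f' (pairInOrder (!t) ⟨a, true, σa⟩ ⟨b, true, σb⟩) s₁ t₁ ∧
      ColorWalk f' (pairInOrder (!m) ⟨a, false, σa⟩ ⟨c, true, σc⟩) s₂ t₂ ∧
      ColorWalk f' (pairInOrder (!l) ⟨b, false, σb⟩ ⟨c, false, σc⟩) s₃ t₃ ∧
      (f' a).weight h + (f' b).weight h + (f' c).weight h =
        (f a).weight h + (f b).weight h + (f c).weight h ∧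
      ((f' a).Trivial → (f' b).Trivial → (f' c).Trivial →
        (f a).Trivial ∧ (f b).Trivial ∧ (f c).Trivial) := by
  subst hσa hσb hσc
  obtain ⟨g, ga, gb, gc, hA, hB, hC⟩ := r3_colors f hf a b c t m l k hT hM hL
  set A := Corners.ofSides (k == l) (fun T M => g T M (!(t == (k == m)))) with hA'
  set B := Corners.ofSides (k == m) (fun T L => g T (t == (k == l)) L) with hB'
  set C := Corners.ofSides (k == t) (fun M L => g (!(m == (k == l))) M L) with hC'
  set f' : ℕ → Corners (ZMod p) :=
    Function.update (Function.update (Function.update f a A) b B) c C with hf'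
  have fc : f' c = C := Function.update_self ..
  have fb : f' b = B := by
    rw [hf', Function.update_of_ne hbc, Function.update_self]
  have fa : f' a = A := by
    rw [hf', Function.update_of_ne hac, Function.update_of_ne hab, Function.update_self]
  have fo : ∀ n, n ≠ a → n ≠ b → n ≠ c → f n = f' n := by
    intro n h1 h2 h3
    rw [hf', Function.update_of_ne h3, Function.update_of_ne h2, Function.update_of_ne h1]
  obtain ⟨w1, w2, w3⟩ := r3_walks g f f' a b c t m l k ga gb gc fa fb fc hT hM hL
  refine ⟨f', fun n => ?_, fo, w1, w2, w3, ?_, ?_⟩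
  · by_cases h3 : n = c
    · rw [h3, fc]; exact Corners.ofSides_balanced.2 (hC _)
    by_cases h2 : n = b
    · rw [h2, fb]; exact Corners.ofSides_balanced.2 (hB _)
    by_cases h1 : n = a
    · rw [h1, fa]; exact Corners.ofSides_balanced.2 (hA _)
    rw [← fo n h1 h2 h3]; exact hf n
  · rw [fa, fb, fc, ga, gb, gc]
    exact r3_weight hp hh g hA hB hC t m l k
  · rw [fa, fb, fc, ga, gb, gc]
    simp only [hA', hB', hC', Corners.ofSides_trivial]
    have a1 := hA true
    have a2 := hA false
    have b1 := hB true
    have b2 := hB false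
    have c1 := hC true
    have c2 := hC false
    clear * - a1 a2 b1 b2 c1 c2
    cases t <;> cases m <;> cases l <;> cases k <;>
    · simp only [show (true == true) = true from rfl, show (true == false) = false from rfl,
      show (false == true) = false from rfl, show (false == false) = true from rfl,
      Bool.not_true, Bool.not_false]
      grind

theorem wordWeight_pairInOrder (f : ℕ → Corners (ZMod p)) (t : Bool) (x y : Pass) :
    wordWeight h f (pairInOrder t x y) =
      (if x.isOver then (f x.crossing).weight h else 0) +
        (if y.isOver then (f y.crossing).weight h else 0) := by
  cases t <;> simp [wordWeight, pairInOrder, add_comm]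

theorem mem_pairInOrder {t : Bool} {x y z : Pass} :
    z ∈ pairInOrder t x y ↔ z = x ∨ z = y := by
  cases t <;> simp [pairInOrder, or_comm]

/-- The labels in a move of type III are different, and do not occur elsewhere. -/
theorem r3_labels {W u T M L : List Pass} (hW : IsGaussCode W) (t m l : Bool)
    {a b c : ℕ} {σa σb σc : Bool}
    (hT : T = pairInOrder t ⟨a, true, σa⟩ ⟨b, true, σb⟩)
    (hM : M = pairInOrder m ⟨a, false, σa⟩ ⟨c, true, σc⟩)
    (hL : L = pairInOrder l ⟨b, false, σb⟩ ⟨c, false, σc⟩)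
    (hperm : W.Perm (T ++ M ++ L ++ u)) :
    a ≠ b ∧ a ≠ c ∧ b ≠ c ∧ ∀ x ∈ u, x.crossing ≠ a ∧ x.crossing ≠ b ∧ x.crossing ≠ c := by
  have hn := ((hperm.map _).nodup_iff).1 hW.1
  subst hT hM hL
  have hn' : (((pairInOrder t ⟨a, true, σa⟩ ⟨b, true, σb⟩ ++
      pairInOrder m ⟨a, false, σa⟩ ⟨c, true, σc⟩ ++
      pairInOrder l ⟨b, false, σb⟩ ⟨c, false, σc⟩).map
      fun x : Pass => (x.crossing, x.isOver))).Nodup := by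
    rw [List.map_append] at hn
    exact hn.of_append_left
  refine ⟨?_, ?_, ?_, ?_⟩
  · rintro rfl
    cases t <;> simp [pairInOrder] at hn'
  · rintro rfl
    cases t <;> cases m <;> simp [pairInOrder] at hn'
  · rintro rfl
    cases t <;> cases m <;> simp [pairInOrder] at hn'
  · intro x hx
    have key : ∀ y ∈ pairInOrder t ⟨a, true, σa⟩ ⟨b, true, σb⟩ ++
      pairInOrder m ⟨a, false, σa⟩ ⟨c, true, σc⟩ ++
      pairInOrder l ⟨b, false, σb⟩ ⟨c, false, σc⟩, (x.crossing, x.isOver) ≠ (y.crossing, y.isOver) := by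
      intro y hy he
      rw [List.map_append, List.nodup_append] at hn
      exact hn.2.2 _ (List.mem_map_of_mem hy) _ (List.mem_map_of_mem hx) he.symm
    have k1 := key ⟨a, true, σa⟩ (by simp [mem_pairInOrder])
    have k2 := key ⟨a, false, σa⟩ (by simp [mem_pairInOrder])
    have k3 := key ⟨b, true, σb⟩ (by simp [mem_pairInOrder])
    have k4 := key ⟨b, false, σb⟩ (by simp [mem_pairInOrder])
    have k5 := key ⟨c, true, σc⟩ (by simp [mem_pairInOrder])
    have k6 := key ⟨c, false, σc⟩ (by simp [mem_pairInOrder])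
    simp only [ne_eq, Prod.mk.injEq, not_and] at k1 k2 k3 k4 k5 k6
    refine ⟨fun e => ?_, fun e => ?_, fun e => ?_⟩ <;>
      cases ho : x.isOver <;> simp_all

/-- A nontrivial coloring of weight zero survives a change at three crossings with the properties
of a move of type III. -/
theorem hasZero_of_r3_core {W W' u T M L T' M' L' : List Pass} {a b c : ℕ}
    {t m l t' m' l' σa σb σc : Bool}
    (hT : T = pairInOrder t ⟨a, true, σa⟩ ⟨b, true, σb⟩)
    (hM : M = pairInOrder m ⟨a, false, σa⟩ ⟨c, true, σc⟩)
    (hL : L = pairInOrder l ⟨b, false, σb⟩ ⟨c, false, σc⟩)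
    (hT' : T' = pairInOrder t' ⟨a, true, σa⟩ ⟨b, true, σb⟩)
    (hM' : M' = pairInOrder m' ⟨a, false, σa⟩ ⟨c, true, σc⟩)
    (hL' : L' = pairInOrder l' ⟨b, false, σb⟩ ⟨c, false, σc⟩)
    (hW : W.Perm (T ++ M ++ L ++ u)) (hW' : W'.Perm (T' ++ M' ++ L' ++ u))
    {f f' : ℕ → Corners (ZMod p)} (hf' : ∀ n, (f' n).Balanced) (hfu : ∀ x ∈ u, f x.crossing = f' x.crossing)
    (hw : (f' a).weight h + (f' b).weight h + (f' c).weight h =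
        (f a).weight h + (f b).weight h + (f c).weight h)
    (ht : (f' a).Trivial → (f' b).Trivial → (f' c).Trivial →
        (f a).Trivial ∧ (f b).Trivial ∧ (f c).Trivial)
    (hx : ∃ x ∈ W, ¬ (f x.crossing).Trivial) (h0 : wordWeight h f W = 0)
    (hs : ∃ s, ColorWalk f' W' s s) : HasZero h W' := by
  refine ⟨f', hf', hs, ?_, ?_⟩
  · by_contra! hcon
    obtain ⟨x, hx, hx'⟩ := hx
    have hcon' : ∀ y ∈ T' ++ M' ++ L' ++ u, (f' y.crossing).Trivial :=
      fun y hy => hcon y (hW'.mem_iff.2 hy)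
    obtain ⟨ra, rb, rc⟩ := ht (hcon' ⟨a, true, σa⟩ (by simp [hT', mem_pairInOrder]))
      (hcon' ⟨b, true, σb⟩ (by simp [hT', mem_pairInOrder]))
      (hcon' ⟨c, true, σc⟩ (by simp [hM', mem_pairInOrder]))
    apply hx'
    have := hW.mem_iff.1 hx
    simp only [hT, hM, hL, List.mem_append, mem_pairInOrder] at this
    rcases this with (((rfl | rfl) | (rfl | rfl)) | (rfl | rfl)) | hu
    any_goals assumption
    rw [hfu x hu]
    exact hcon' x (by simp [hu])
  · rw [wordWeight_perm h _ hW] at h0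
    rw [wordWeight_perm h _ hW', ← h0]
    simp only [hT, hM, hL, hT', hM', hL', wordWeight_append, wordWeight_pairInOrder,
      wordWeight_congr h hfu, if_true, Bool.false_eq_true, if_false]
    linear_combination hw

/-- The signs are variables subject to equations, so that the inverse move is again an instance,
with `!k` in place of `k`. -/
theorem HasZero.r3_tml (hp : p ≠ 0) (hh : IsLift h) {u v w : List Pass} {a b c : ℕ}
    {t m l k σa σb σc : Bool} (hσa : σa = (k == l)) (hσb : σb = (k == m)) (hσc : σc = (k == t))
    (hW : IsGaussCode (pairInOrder t ⟨a, true, σa⟩ ⟨b, true, σb⟩ ++ u ++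
      pairInOrder m ⟨a, false, σa⟩ ⟨c, true, σc⟩ ++ v ++
      pairInOrder l ⟨b, false, σb⟩ ⟨c, false, σc⟩ ++ w))
    (H : HasZero h (pairInOrder t ⟨a, true, σa⟩ ⟨b, true, σb⟩ ++ u ++
      pairInOrder m ⟨a, false, σa⟩ ⟨c, true, σc⟩ ++ v ++
      pairInOrder l ⟨b, false, σb⟩ ⟨c, false, σc⟩ ++ w)) :
    HasZero h (pairInOrder (!t) ⟨a, true, σa⟩ ⟨b, true, σb⟩ ++ u ++
      pairInOrder (!m) ⟨a, false, σa⟩ ⟨c, true, σc⟩ ++ v ++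
      pairInOrder (!l) ⟨b, false, σb⟩ ⟨c, false, σc⟩ ++ w) := by
  have hperm : ∀ T M L : List Pass,
      (T ++ u ++ M ++ v ++ L ++ w).Perm (T ++ M ++ L ++ (u ++ v ++ w)) := by
    intro T M L
    rw [← Multiset.coe_eq_coe]
    simp only [← Multiset.coe_add]
    abel
  obtain ⟨f, hf, ⟨s, hs⟩, hx, h0⟩ := H
  obtain ⟨hab, hac, hbc, hne⟩ := r3_labels hW t m l rfl rfl rfl (hperm _ _ _)
  simp only [ColorWalk, Walk.append_iff] at hs
  obtain ⟨s5, ⟨s4, ⟨s3, ⟨s2, ⟨s1, wT, wu⟩, wM⟩, wv⟩, wL⟩, ww⟩ := hs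
  obtain ⟨f', hf', hff, wT', wM', wL', hw, ht⟩ :=
    r3_core hp hh f hf hab hac hbc t m l k hσa hσb hσc wT wM wL
  have hfu : ∀ x ∈ u ++ v ++ w, f x.crossing = f' x.crossing := fun x hx =>
    hff _ (hne x hx).1 (hne x hx).2.1 (hne x hx).2.2
  refine hasZero_of_r3_core rfl rfl rfl rfl rfl rfl (hperm _ _ _) (hperm _ _ _) hf' hfu hw ht hx h0
    ⟨s, ?_⟩
  simp only [ColorWalk, Walk.append_iff]
  exact ⟨s5, ⟨s4, ⟨s3, ⟨s2, ⟨s1, wT', (colorWalk_congr fun x hx => hfu x (by simp [hx])).1 wu⟩, wM'⟩,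
    (colorWalk_congr fun x hx => hfu x (by simp [hx])).1 wv⟩, wL'⟩,
    (colorWalk_congr fun x hx => hfu x (by simp [hx])).1 ww⟩

theorem HasZero.r3_tlm (hp : p ≠ 0) (hh : IsLift h) {u v w : List Pass} {a b c : ℕ}
    {t m l k σa σb σc : Bool} (hσa : σa = (k == l)) (hσb : σb = (k == m)) (hσc : σc = (k == t))
    (hW : IsGaussCode (pairInOrder t ⟨a, true, σa⟩ ⟨b, true, σb⟩ ++ u ++
      pairInOrder l ⟨b, false, σb⟩ ⟨c, false, σc⟩ ++ v ++
      pairInOrder m ⟨a, false, σa⟩ ⟨c, true, σc⟩ ++ w))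
    (H : HasZero h (pairInOrder t ⟨a, true, σa⟩ ⟨b, true, σb⟩ ++ u ++
      pairInOrder l ⟨b, false, σb⟩ ⟨c, false, σc⟩ ++ v ++
      pairInOrder m ⟨a, false, σa⟩ ⟨c, true, σc⟩ ++ w)) :
    HasZero h (pairInOrder (!t) ⟨a, true, σa⟩ ⟨b, true, σb⟩ ++ u ++
      pairInOrder (!l) ⟨b, false, σb⟩ ⟨c, false, σc⟩ ++ v ++
      pairInOrder (!m) ⟨a, false, σa⟩ ⟨c, true, σc⟩ ++ w) := by
  have hperm : ∀ T M L : List Pass,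
      (T ++ u ++ L ++ v ++ M ++ w).Perm (T ++ M ++ L ++ (u ++ v ++ w)) := by
    intro T M L
    rw [← Multiset.coe_eq_coe]
    simp only [← Multiset.coe_add]
    abel
  obtain ⟨f, hf, ⟨s, hs⟩, hx, h0⟩ := H
  obtain ⟨hab, hac, hbc, hne⟩ := r3_labels hW t m l rfl rfl rfl (hperm _ _ _)
  simp only [ColorWalk, Walk.append_iff] at hs
  obtain ⟨s5, ⟨s4, ⟨s3, ⟨s2, ⟨s1, wT, wu⟩, wL⟩, wv⟩, wM⟩, ww⟩ := hs
  obtain ⟨f', hf', hff, wT', wM', wL', hw, ht⟩ :=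
    r3_core hp hh f hf hab hac hbc t m l k hσa hσb hσc wT wM wL
  have hfu : ∀ x ∈ u ++ v ++ w, f x.crossing = f' x.crossing := fun x hx =>
    hff _ (hne x hx).1 (hne x hx).2.1 (hne x hx).2.2
  refine hasZero_of_r3_core rfl rfl rfl rfl rfl rfl (hperm _ _ _) (hperm _ _ _) hf' hfu hw ht hx h0
    ⟨s, ?_⟩
  simp only [ColorWalk, Walk.append_iff]
  exact ⟨s5, ⟨s4, ⟨s3, ⟨s2, ⟨s1, wT', (colorWalk_congr fun x hx => hfu x (by simp [hx])).1 wu⟩, wL'⟩,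
    (colorWalk_congr fun x hx => hfu x (by simp [hx])).1 wv⟩, wM'⟩,
    (colorWalk_congr fun x hx => hfu x (by simp [hx])).1 ww⟩


variable {p : ℕ} {h : ZMod p → ℤ}

/-! ### The second Reidemeister move -/

/-- Given the sums `o` and `l` of the colors beside the over-strand and beside the right half of the
under-strand, the sum of the colors beside a pass that enters the crossing. -/
def foxIn {R : Type*} [CommRing R] (o l : ℕ → R) (x : Pass) : R :=
  if x.isOver then o x.crossing
  else if x.isPositive then l x.crossing else 2 * o x.crossing - l x.crossing

/-- The sum of the colors beside a pass that leaves the crossing. -/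
def foxOut {R : Type*} [CommRing R] (o l : ℕ → R) (x : Pass) : R :=
  if x.isOver then o x.crossing
  else if x.isPositive then 2 * o x.crossing - l x.crossing else l x.crossing

section

variable {R : Type*} [CommRing R]

theorem foxIn_eq {o l : ℕ → R} {f : ℕ → Corners R} (hf : ∀ n, (f n).Balanced) {x : Pass}
    (h1 : (f x.crossing).x₁ + (f x.crossing).x₃ = o x.crossing)
    (h2 : (f x.crossing).x₃ + (f x.crossing).x₄ = l x.crossing) :
    foxIn o l x = ((f x.crossing).entry x).1 + ((f x.crossing).entry x).2 ∧
      foxOut o l x = ((f x.crossing).exit x).1 + ((f x.crossing).exit x).2 := by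
  have hb := hf x.crossing
  unfold Corners.Balanced at hb
  unfold foxIn foxOut Corners.entry Corners.exit
  split_ifs <;> constructor <;> simp only [] <;> grind

/-- Two colorings with the same sums and the same initial state agree. -/
theorem eq_of_colorWalk {f g : ℕ → Corners R} (hf : ∀ n, (f n).Balanced)
    (hg : ∀ n, (g n).Balanced) {w : List Pass} {s t t' : R × R} (hfw : ColorWalk f w s t)
    (hgw : ColorWalk g w s t')
    (h1 : ∀ x ∈ w, (f x.crossing).x₁ + (f x.crossing).x₃ = (g x.crossing).x₁ + (g x.crossing).x₃)
    (h2 : ∀ x ∈ w, (f x.crossing).x₃ + (f x.crossing).x₄ = (g x.crossing).x₃ + (g x.crossing).x₄) :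
    (∀ x ∈ w, f x.crossing = g x.crossing) ∧ t = t' := by
  induction w generalizing s with
  | nil => exact ⟨by simp, Eq.trans (Eq.symm hfw) hgw⟩
  | cons x w ih =>
    have e := hfw.1.symm.trans hgw.1
    have hx : f x.crossing = g x.crossing := by
      have b1 := hf x.crossing
      have b2 := hg x.crossing
      have e1 := h1 x (by simp)
      have e2 := h2 x (by simp)
      unfold Corners.Balanced at b1 b2
      replace e : (f x.crossing).entry x = (g x.crossing).entry x := e
      unfold Corners.entry at e
      rw [Corners.ext_iff]
      split_ifs at e <;> simp only [Prod.mk.injEq] at e <;> grind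
    have hgw' := hgw.2
    have hfw' := hfw.2
    simp only [← hx] at hgw'
    obtain ⟨k1, k2⟩ := ih hfw' hgw' (fun y hy => h1 y (by simp [hy]))
      (fun y hy => h2 y (by simp [hy]))
    refine ⟨fun y hy => ?_, k2⟩
    rcases List.mem_cons.1 hy with rfl | hy
    · exact hx
    · exact k1 y hy

/-- The corners at the second crossing of a bigon. -/
theorem bigon_corners {f : ℕ → Corners R} (hf : ∀ n, (f n).Balanced) {x y : Pass}
    (ho : x.isOver = y.isOver) (hs : x.isPositive ≠ y.isPositive) {z : List Pass}
    (hz : z = [x.other, y.other] ∨ z = [y.other, x.other]) {s s' t t' : R × R}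
    (h1 : ColorWalk f [x, y] s s') (h2 : ColorWalk f z t t') :
    f y.crossing = ⟨(f x.crossing).x₂, (f x.crossing).x₁, (f x.crossing).x₄, (f x.crossing).x₃⟩ ∧
      s' = s ∧ t' = t := by
  have b1 := hf x.crossing
  have b2 := hf y.crossing
  unfold Corners.Balanced at b1 b2
  obtain ⟨cx, ox, px⟩ := x
  obtain ⟨cy, oy, py⟩ := y
  simp only at ho hs b1 b2
  subst ho
  obtain rfl : py = !px := by cases px <;> cases py <;> simp_all
  rcases hz with rfl | rfl <;> cases ox <;> cases px <;>
  · simp [ColorWalk, Corners.entry, Corners.exit, Pass.other, Prod.ext_iff] at h1 h2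
    simp only [Corners.ext_iff, Prod.ext_iff]
    grind

end

/-- The defect changes its sign, while the factor `x₁ - x₄` becomes `x₂ - x₃`, which is equal to it
by the Dehn condition. -/
theorem Corners.bigon_weight (hp : p ≠ 0) (hh : IsLift h) {q r : Corners (ZMod p)}
    (hq : q.Balanced) (hr : r = ⟨q.x₂, q.x₁, q.x₄, q.x₃⟩) : q.weight h + r.weight h = 0 := by
  have hr' : r.Balanced := by subst hr; exact Eq.symm hq
  have h1 := mul_defect hh hq
  have h2 := mul_defect hh hr'
  have h3 : r.defect h = - q.defect h := by
    apply mul_left_cancel₀ (show (p : ℤ) ≠ 0 by exact_mod_cast hp)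
    rw [h2, mul_neg, h1, hr]
    ring
  unfold weight
  rw [h3]
  subst hr
  unfold Balanced at hq
  push_cast
  linear_combination (q.defect h : ZMod p) * hq

section

variable {x y : Pass} {u v z : List Pass} {f : ℕ → Corners (ZMod p)}

/-- A coloring of a diagram restricts to the diagram without a bigon. -/
theorem remove_bigon (hp : p ≠ 0) (hh : IsLift h) (hf : ∀ n, (f n).Balanced)
    (ho : x.isOver = y.isOver) (hs : x.isPositive ≠ y.isPositive)
    (hz : z = [x.other, y.other] ∨ z = [y.other, x.other]) {s : ZMod p × ZMod p}
    (H : ColorWalk f ([x, y] ++ u ++ z ++ v) s s) :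
    ColorWalk f (u ++ v) s s ∧
      wordWeight h f (u ++ v) = wordWeight h f ([x, y] ++ u ++ z ++ v) ∧
      ((∀ a ∈ u ++ v, (f a.crossing).Trivial) →
        (f x.crossing).Trivial ∧ (f y.crossing).Trivial) := by
  simp only [ColorWalk, Walk.append_iff] at H
  obtain ⟨t', ⟨t, ⟨s', w1, w2⟩, w3⟩, w4⟩ := H
  obtain ⟨hxy, rfl, rfl⟩ := bigon_corners hf ho hs hz w1 w3
  refine ⟨Walk.append_iff.2 ⟨_, w2, w4⟩, ?_, fun ht => ?_⟩
  · have hw := Corners.bigon_weight hp hh (hf x.crossing) hxy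
    simp only [wordWeight_append]
    have : wordWeight h f [x, y] + wordWeight h f z = 0 := by
      rcases hz with rfl | rfl <;> cases hx : x.isOver <;>
      · simp [wordWeight, hx, ← ho]
        linear_combination hw
    linear_combination -this
  -- If all other crossings are trivially colored, the sum of the two colors beside the strand is
  -- constant along `u`. So both strands of the bigon have the same sum, which forces the crossings
  -- of the bigon to be trivial.
  · obtain ⟨e1, -⟩ := Walk.invariant (fun a : ZMod p × ZMod p => a.1 + a.2 = s'.1 + s'.2)
      (fun a ha hP => ((ht a (by simp [ha])).sum_exit a).trans hP) w2 rfl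
    have hx : s' = (f x.crossing).entry x := w1.1
    have hy : t' = (f x.crossing).entry x.other ∨ t' = (f y.crossing).entry y.other := by
      rcases hz with rfl | rfl
      · exact Or.inl w3.1
      · exact Or.inr w3.1
    have b := hf x.crossing
    unfold Corners.Balanced at b
    have key : (f x.crossing).Trivial := by
      unfold Corners.Trivial
      simp only [hx] at e1
      rcases hy with hy | hy <;> rw [hy] at e1
      · unfold Corners.entry at e1
        cases h1 : x.isOver <;> cases h2 : x.isPositive <;>
          simp [h1, h2] at e1 <;> constructor <;> grind
      · rw [hxy] at e1
        unfold Corners.entry at e1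
        cases h1 : x.isOver <;> cases h2 : x.isPositive <;> cases h3 : y.isPositive <;>
          simp [h1, h2, h3, ← ho] at e1 hs <;> constructor <;> grind
    refine ⟨key, ?_⟩
    rw [hxy]
    exact ⟨key.2.symm, key.1.symm⟩

theorem HasZero.remove_bigon (hp : p ≠ 0) (hh : IsLift h)
    (ho : x.isOver = y.isOver) (hs : x.isPositive ≠ y.isPositive)
    (hz : z = [x.other, y.other] ∨ z = [y.other, x.other])
    (H : HasZero h ([x, y] ++ u ++ z ++ v)) : HasZero h (u ++ v) := by
  obtain ⟨f, hf, ⟨s, hw⟩, ⟨a, ha, ha'⟩, h0⟩ := H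
  obtain ⟨k1, k2, k3⟩ := _root_.remove_bigon hp hh hf ho hs hz hw
  refine ⟨f, hf, ⟨s, k1⟩, ?_, k2.trans h0⟩
  by_contra! hcon
  obtain ⟨hx, hy⟩ := k3 hcon
  apply ha'
  have : a.crossing = x.crossing ∨ a.crossing = y.crossing ∨ a ∈ u ++ v := by
    rcases hz with rfl | rfl <;>
    · simp only [List.mem_append, List.mem_cons, List.not_mem_nil, or_false] at ha
      rcases ha with (((rfl | rfl) | h) | (rfl | rfl)) | h <;> simp_all
  rcases this with h | h | h
  · rwa [h]
  · rwa [h]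
  · exact hcon a h

/-- The sums of colors of a coloring extend to a diagram with a new bigon. -/
theorem exists_fox_bigon (hW : IsGaussCode ([x, y] ++ u ++ z ++ v)) (hf : ∀ n, (f n).Balanced)
    (ho : x.isOver = y.isOver) (hs : x.isPositive ≠ y.isPositive)
    (hz : z = [x.other, y.other] ∨ z = [y.other, x.other]) {s : ZMod p × ZMod p}
    (H : ColorWalk f (u ++ v) s s) :
    ∃ o l : ℕ → ZMod p,
      Walk (foxIn o l) (foxOut o l) ([x, y] ++ u ++ z ++ v) (s.1 + s.2) (s.1 + s.2) ∧
      ∀ a ∈ u ++ v, (f a.crossing).x₁ + (f a.crossing).x₃ = o a.crossing ∧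
        (f a.crossing).x₃ + (f a.crossing).x₄ = l a.crossing := by
  have hne : ∀ a ∈ u ++ v, a.crossing ≠ x.crossing ∧ a.crossing ≠ y.crossing := by
    intro a ha
    have hperm : ([x, y] ++ u ++ z ++ v).Perm (([x, y] ++ z) ++ (u ++ v)) := by
      rw [← Multiset.coe_eq_coe]
      simp only [← Multiset.coe_add]
      abel
    have hz' : x.other ∈ z ∧ y.other ∈ z := by rcases hz with rfl | rfl <;> simp
    exact ⟨hW.ne_crossing_of_append hperm (x := x) (by simp) (by simp [hz'.1]) a ha,
      hW.ne_crossing_of_append hperm (x := y) (by simp) (by simp [hz'.2]) a ha⟩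
  obtain ⟨t, w1, w2⟩ := Walk.append_iff.1 H
  obtain ⟨d, hd⟩ : ∃ d : Bool, z = if d then [x.other, y.other] else [y.other, x.other] := by
    rcases hz with h | h
    · exact ⟨true, h⟩
    · exact ⟨false, h⟩
  set A := s.1 + s.2 with hA
  set B := t.1 + t.2 with hB
  -- `A` and `B` are the sums with which the strand enters `[x, y]` and `z`. `O` is the one of the
  -- over-strand; `E` belongs to the right half of the under-strand, which is common to both
  -- crossings. It is the incoming sum if the first crossing met by the under-strand is positive,
  -- and the reflected one otherwise; `x.isPositive = d` says that this crossing is positive when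
  -- `z` is the under-strand.
  set O : ZMod p := if x.isOver then A else B
  set E : ZMod p := if x.isOver then
    (if x.isPositive = d then B else 2 * A - B)
    else (if x.isPositive then A else 2 * B - A)
  set o : ℕ → ZMod p := fun n => if n = x.crossing ∨ n = y.crossing then O
    else (f n).x₁ + (f n).x₃ with ho'
  set l : ℕ → ZMod p := fun n => if n = x.crossing ∨ n = y.crossing then E
    else (f n).x₃ + (f n).x₄ with hl'
  have hsum : ∀ a ∈ u ++ v, (f a.crossing).x₁ + (f a.crossing).x₃ = o a.crossing ∧
        (f a.crossing).x₃ + (f a.crossing).x₄ = l a.crossing := by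
    intro a ha
    have := hne a ha
    simp [ho', hl', this.1, this.2]
  have hstep : ∀ a ∈ u ++ v, ((f a.crossing).entry a).1 + ((f a.crossing).entry a).2 = foxIn o l a ∧
      ((f a.crossing).exit a).1 + ((f a.crossing).exit a).2 = foxOut o l a := fun a ha =>
    have := foxIn_eq hf (hsum a ha).1 (hsum a ha).2
    ⟨this.1.symm, this.2.symm⟩
  refine ⟨o, l, ?_, hsum⟩
  simp only [Walk.append_iff]
  have ox : o x.crossing = O := by simp [ho']
  have oy : o y.crossing = O := by simp [ho']
  have lx : l x.crossing = E := by simp [hl']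
  have ly : l y.crossing = E := by simp [hl']
  have hpos : y.isPositive = !x.isPositive := by
    revert hs
    cases x.isPositive <;> cases y.isPositive <;> simp
  refine ⟨B, ⟨B, ⟨A, ?_, ?_⟩, ?_⟩, ?_⟩
  · cases hx : x.isOver <;> cases hp : x.isPositive <;>
      simp [foxIn, foxOut, ox, oy, lx, ly, hx, hp, ← ho, hpos, O, E]
  · exact (Walk.congr fun a ha => hstep a (by simp [ha])).1
      (w1.map_state fun a : ZMod p × ZMod p => a.1 + a.2)
  · rw [hd]
    cases d <;> cases hx : x.isOver <;> cases hp : x.isPositive <;>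
      simp [foxIn, foxOut, ox, oy, lx, ly, hx, hp, ← ho, hpos, O, E]
  · exact (Walk.congr fun a ha => hstep a (by simp [ha])).1
      (w2.map_state fun a : ZMod p × ZMod p => a.1 + a.2)

end


/-! ### Colors of regions and colors of corners -/

section Regions

variable {w : List Pass} {R : Type*}

/-- The two passes of a crossing have the opposite roles. -/
theorem IsGaussCode.exists_partner (hw : IsGaussCode w) (i : Fin w.length) :
    ∃ k, w.get k = (w.get i).other := by
  obtain ⟨k, hk⟩ := List.get_of_mem (hw.2 _ (List.get_mem w i))
  exact ⟨k, hk⟩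

theorem IsGaussCode.get_injective (hw : IsGaussCode w) : Function.Injective w.get :=
  List.nodup_iff_injective_get.1 hw.nodup

theorem IsCrossing.under_isOver {j i : Fin w.length} (h : IsCrossing w j i) :
    (w.get i).isOver = false := by
  rw [h.2, Pass.other_isOver, h.1]; rfl

theorem IsCrossing.crossing_eq {j i : Fin w.length} (h : IsCrossing w j i) :
    (w.get i).crossing = (w.get j).crossing := by
  rw [h.2]; rfl

theorem IsCrossing.unique (hw : IsGaussCode w) {j i j' i' : Fin w.length} (h : IsCrossing w j i)
    (h' : IsCrossing w j' i') (hc : (w.get j).crossing = (w.get j').crossing) : j = j' ∧ i = i' := by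
  have hj : w.get j = w.get j' :=
    hw.eq_of_crossing (List.get_mem w j) (List.get_mem w j') hc (h.1.trans h'.1.symm)
  refine ⟨hw.get_injective hj, hw.get_injective ?_⟩
  rw [h.2, h'.2, hj]

theorem isCrossing_or (hw : IsGaussCode w) (k : Fin w.length) :
    ∃ k', (IsCrossing w k k' ∧ (w.get k).isOver = true) ∨
      (IsCrossing w k' k ∧ (w.get k).isOver = false) := by
  obtain ⟨k', hk'⟩ := hw.exists_partner k
  refine ⟨k', ?_⟩
  cases ho : (w.get k).isOver
  · refine Or.inr ⟨⟨?_, ?_⟩, rfl⟩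
    · rw [hk', Pass.other_isOver, ho]; rfl
    · rw [hk', Pass.other_other]
  · exact Or.inl ⟨⟨ho, hk'⟩, rfl⟩

/-- The colors of the corners of the crossing with over-pass `j`. -/
def cornersAt (C : Region w → R) (j : Fin w.length) : Corners R :=
  ⟨C (region j.castSucc .left), C (region j.succ .left), C (region j.castSucc .right),
    C (region j.succ .right)⟩

theorem cornersAt_over (C : Region w → R) {j i : Fin w.length} (h : IsCrossing w j i) :
    (C (region j.castSucc .left), C (region j.castSucc .right)) =
        (cornersAt C j).entry (w.get j) ∧
      (C (region j.succ .left), C (region j.succ .right)) = (cornersAt C j).exit (w.get j) := by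
  have := h.1
  simp only [Corners.entry, Corners.exit, this, if_true, cornersAt, and_self]

/-- Along the over-strand the corners are colors beside it by definition; for the under-strand this
is what the eight corner relations of `Adjoin` provide. -/
theorem cornersAt_under (C : Region w → R) {j i : Fin w.length} (h : IsCrossing w j i) :
    (C (region i.castSucc .left), C (region i.castSucc .right)) =
        (cornersAt C j).entry (w.get i) ∧
      (C (region i.succ .left), C (region i.succ .right)) = (cornersAt C j).exit (w.get i) := by
  have ho := h.under_isOver
  have hp : (w.get i).isPositive = (w.get j).isPositive := by rw [h.2]; rfl
  have eq : ∀ {a b : Semiarc w × Side}, Adjoin w a b →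
    C (Quot.mk _ a) = C (Quot.mk _ b) := fun hab => congrArg C (Quot.sound hab)
  cases hs : (w.get j).isPositive
  · simp only [Corners.entry, Corners.exit, ho, hp, hs, cornersAt, Bool.false_eq_true, if_false]
    exact ⟨Prod.ext (eq (.neg_out_left j i h hs)).symm (eq (.neg_in_left j i h hs)).symm,
      Prod.ext (eq (.neg_out_right j i h hs)).symm (eq (.neg_in_right j i h hs)).symm⟩
  · simp only [Corners.entry, Corners.exit, ho, hp, hs, cornersAt, Bool.false_eq_true, if_false,
      if_true]
    exact ⟨Prod.ext (eq (.pos_in_right j i h hs)).symm (eq (.pos_out_right j i h hs)).symm,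
      Prod.ext (eq (.pos_in_left j i h hs)).symm (eq (.pos_out_left j i h hs)).symm⟩

/-- Colors of regions give a closed walk through the colors of the corners. -/
theorem exists_corners [Zero R] (hw : IsGaussCode w) (C : Region w → R) :
    ∃ f : ℕ → Corners R,
      (∀ n, f n = ⟨0, 0, 0, 0⟩ ∨ ∃ j i, IsCrossing w j i ∧ f n = cornersAt C j) ∧
      (∀ j i, IsCrossing w j i → f (w.get j).crossing = cornersAt C j) ∧
      ColorWalk f w (C (region 0 .left), C (region 0 .right))
        (C (region 0 .left), C (region 0 .right)) := by
  classical
  -- Labels that do not occur get zero corners, which satisfy the Dehn condition, so that it can be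
  -- required at all labels.
  set f : ℕ → Corners R := fun n =>
    if h : ∃ j i, IsCrossing w j i ∧ (w.get j).crossing = n then cornersAt C h.choose
    else ⟨0, 0, 0, 0⟩ with hf
  have hfj : ∀ j i, IsCrossing w j i → f (w.get j).crossing = cornersAt C j := by
    intro j i hji
    have hex : ∃ j' i', IsCrossing w j' i' ∧ (w.get j').crossing = (w.get j).crossing :=
      ⟨j, i, hji, rfl⟩
    simp only [hf]
    rw [dif_pos hex]
    obtain ⟨i', h1, h2⟩ := hex.choose_spec
    rw [(h1.unique hw hji h2).1]
  refine ⟨f, fun n => ?_, hfj, ?_⟩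
  · by_cases hn : ∃ j i, IsCrossing w j i ∧ (w.get j).crossing = n
    · obtain ⟨j, i, h1, rfl⟩ := hn
      exact Or.inr ⟨j, i, h1, hfj j i h1⟩
    · exact Or.inl (dif_neg hn)
  · have key := Walk.of_states (i := fun x : Pass => (f x.crossing).entry x)
      (o := fun x : Pass => (f x.crossing).exit x)
      (fun u : Semiarc w => (C (region u .left), C (region u .right))) fun k => by
        obtain ⟨k', ⟨hk, -⟩ | ⟨hk, -⟩⟩ := isCrossing_or hw k
        · rw [hfj k k' hk]
          exact cornersAt_over C hk
        · have := hk.crossing_eq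
          rw [this, hfj k' k hk]
          exact cornersAt_under C hk
    have hcut : ∀ s, C (region (Fin.last w.length) s) = C (region 0 s) := fun s =>
      congrArg C (Quot.sound (Adjoin.cut s))
    simp only [hcut] at key
    exact key

end Regions

/-! ### Planarity -/

section Planar

variable {w : List Pass} {F : Type*} [Field F]

/-- The functions on semiarcs whose alternating sum around each crossing vanishes. -/
def alternating (F : Type*) [Field F] (w : List Pass) : Submodule F (Semiarc w → F) where
  carrier := {a | a (Fin.last _) = a 0 ∧ ∀ j i, IsCrossing w j i →
    a j.castSucc + a j.succ = a i.castSucc + a i.succ}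
  add_mem' := by
    rintro a b ⟨ha, ha'⟩ ⟨hb, hb'⟩
    refine ⟨by simp [ha, hb], fun j i h => ?_⟩
    have h1 := ha' j i h
    have h2 := hb' j i h
    simp only [Pi.add_apply]
    linear_combination h1 + h2
  zero_mem' := by simp
  smul_mem' := by
    rintro c a ⟨ha, ha'⟩
    refine ⟨by simp [ha], fun j i h => ?_⟩
    have h1 := ha' j i h
    simp only [Pi.smul_apply, smul_eq_mul]
    linear_combination c * h1

/-- An alternating function is determined by its value at the cut point and after the first pass
through each crossing. -/
theorem finrank_alternating_le (hw : IsGaussCode w) :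
    Module.finrank F (alternating F w) ≤ w.length / 2 + 1 := by
  classical
  choose σ hσ using hw.exists_partner
  have hinv : ∀ i, σ (σ i) = i := fun i => hw.get_injective (by rw [hσ, hσ]; simp)
  have hne : ∀ i, σ i ≠ i := fun i h => by
    have := congrArg Pass.isOver (hσ i)
    rw [h] at this
    simp at this
  -- The positions at which a crossing is met for the first time; `σ` exchanges the two passes of a
  -- crossing.
  set A : Finset (Fin w.length) := Finset.univ.filter fun i => i < σ i with hA
  have hcard : A.card ≤ w.length / 2 := by
    have h1 : Disjoint A (A.image σ) := by
      rw [Finset.disjoint_left]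
      intro i hi hi'
      obtain ⟨k, hk, rfl⟩ := Finset.mem_image.1 hi'
      simp only [hA, Finset.mem_filter, Finset.mem_univ, true_and, hinv] at hi hk
      exact lt_asymm hi hk
    have h2 : (A.image σ).card = A.card :=
      Finset.card_image_of_injective _ (Function.LeftInverse.injective hinv)
    have h3 : (A ∪ A.image σ).card ≤ w.length := by
      simpa using Finset.card_le_univ (A ∪ A.image σ)
    rw [Finset.card_union_of_disjoint h1, h2] at h3
    omega
  let L : alternating F w →ₗ[F] (F × (A → F)) :=
    { toFun := fun a => (a.1 0, fun j => a.1 j.1.succ)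
      map_add' := fun a b => rfl
      map_smul' := fun c a => rfl }
  have hL : Function.Injective L := by
    rw [injective_iff_map_eq_zero]
    rintro ⟨a, ha⟩ h0
    have ha' := ha.2
    have h1 : a 0 = 0 := congrArg Prod.fst h0
    have h2 : ∀ j ∈ A, a j.succ = 0 := fun j hj => congrFun (congrArg Prod.snd h0) ⟨j, hj⟩
    have h3 : ∀ i, a i.castSucc + a i.succ = a (σ i).castSucc + a (σ i).succ := by
      intro i
      obtain ⟨k, ⟨hk, -⟩ | ⟨hk, -⟩⟩ := isCrossing_or hw i
      · have : k = σ i := hw.get_injective (by rw [hσ, hk.2])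
        rw [← this]; exact ha' _ _ hk
      · have : k = σ i := hw.get_injective (by rw [hσ, hk.2]; simp)
        rw [← this]; exact (ha' _ _ hk).symm
    -- Induction along the knot: when a crossing is met for the second time, three of its four
    -- semiarcs are already known to have value zero, and the alternating condition gives the
    -- fourth.
    have h4 : ∀ m : ℕ, ∀ k : Semiarc w, k.val = m → a k = 0 := by
      intro m
      induction m using Nat.strong_induction_on with
      | _ m ih =>
        intro k hk
        induction k using Fin.cases with
        | zero => exact h1
        | succ i =>
          by_cases hi : i ∈ A
          · exact h2 i hi
          · have hlt : σ i < i := by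
              simp only [hA, Finset.mem_filter, Finset.mem_univ, true_and, not_lt] at hi
              exact lt_of_le_of_ne hi (hne i)
            have hlt' : (σ i).val < i.val := hlt
            simp only [Fin.val_succ] at hk
            have e := h3 i
            rw [ih _ (by simp; omega) i.castSucc rfl, ih _ (by simp; omega) (σ i).castSucc rfl,
              ih _ (by simp; omega) (σ i).succ rfl] at e
            simpa using e
    ext k
    exact h4 _ k rfl
  calc Module.finrank F (alternating F w) ≤ Module.finrank F (F × (A → F)) :=
        LinearMap.finrank_le_finrank_of_injective hL
    _ = 1 + A.card := by simp
    _ ≤ _ := by omega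

/-- In a planar diagram every alternating function is the sum of the colors of the two adjacent
regions for some coloring of the regions, in which the color of one region can be prescribed. -/
theorem exists_region_colors (D : KnotDiagram) {a : Semiarc D.word → F}
    (ha : a ∈ alternating F D.word) (r : F) :
    ∃ C : Region D.word → F, (∀ u, C (region u .left) + C (region u .right) = a u) ∧
      C (region 0 .right) = r := by
  have := Region.finite D.word
  have := Fintype.ofFinite (Region D.word)
  have key : ∀ (C : Region D.word → F) (j i : Fin D.word.length), IsCrossing D.word j i →
      C (region j.castSucc .left) + C (region j.castSucc .right) +
        (C (region j.succ .left) + C (region j.succ .right)) =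
      C (region i.castSucc .left) + C (region i.castSucc .right) +
        (C (region i.succ .left) + C (region i.succ .right)) := by
    intro C j i h
    obtain ⟨h1, h2⟩ := cornersAt_under C h
    unfold Corners.entry at h1
    unfold Corners.exit at h2
    have ho := h.under_isOver
    rw [ho] at h1 h2
    simp only [Bool.false_eq_true, if_false, cornersAt] at h1 h2
    split_ifs at h1 h2 <;> simp only [Prod.mk.injEq] at h1 h2 <;>
      rw [h1.1, h1.2, h2.1, h2.2] <;> ring
  let L : (Region D.word → F) →ₗ[F] (alternating F D.word × F) :=
    { toFun := fun C => (⟨fun u => C (region u .left) + C (region u .right), by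
          have hcut : ∀ s, C (region (Fin.last _) s) = C (region 0 s) := fun s =>
            congrArg C (Quot.sound (Adjoin.cut s))
          exact ⟨by simp only [hcut], key C⟩⟩, C (region 0 .right))
      map_add' := fun C C' => by
        refine Prod.ext (Subtype.ext (funext fun u => ?_)) rfl
        simp only [Pi.add_apply, Prod.fst_add, Submodule.coe_add]
        ring
      map_smul' := fun c C => by
        refine Prod.ext (Subtype.ext (funext fun u => ?_)) rfl
        simp only [Pi.smul_apply, smul_eq_mul, Prod.smul_fst, SetLike.val_smul, RingHom.id_apply]
        ring }
  have hL : Function.Injective L := by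
    rw [injective_iff_map_eq_zero]
    intro C h0
    have h1 : ∀ u, C (region u .left) + C (region u .right) = 0 := fun u =>
      congrFun (congrArg (fun z => (Subtype.val (Prod.fst z))) h0) u
    have h2 : C (region 0 .right) = 0 := congrArg Prod.snd h0
    -- All sums vanish, so the color changes its sign across each semiarc. Walking along the knot,
    -- the color on the right only changes by crossing other semiarcs, hence it stays zero.
    have h3 : ∀ u : Semiarc D.word, C (region u .right) = 0 := by
      intro u
      induction u using Fin.induction with
      | zero => exact h2
      | succ k ih =>
        obtain ⟨k', ⟨hk, ho⟩ | ⟨hk, ho⟩⟩ := isCrossing_or D.gauss k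
        all_goals
          obtain ⟨e1, e2⟩ := cornersAt_under C hk
          unfold Corners.entry at e1
          unfold Corners.exit at e2
        · have ho' := hk.under_isOver
          rw [ho'] at e1 e2
          have a1 := h1 k'.castSucc
          have a2 := h1 k'.succ
          simp only [Bool.false_eq_true, if_false, cornersAt] at e1 e2
          split_ifs at e1 e2 <;> simp only [Prod.mk.injEq] at e1 e2 <;> grind
        · rw [ho] at e1 e2
          have a1 := h1 k'.castSucc
          have a2 := h1 k'.succ
          simp only [Bool.false_eq_true, if_false, cornersAt] at e1 e2
          split_ifs at e1 e2 <;> simp only [Prod.mk.injEq] at e1 e2 <;> grind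
    funext x
    induction x using Quot.ind with
    | _ x =>
      obtain ⟨u, _ | _⟩ := x
      · have := h1 u
        rw [h3 u, add_zero] at this
        exact this
      · exact h3 u
  -- With `n` crossings, planarity gives the source dimension `n + 2`, and the target has dimension
  -- at most `(n + 1) + 1`. Hence the injective map `L` is bijective.
  have hdim : Module.finrank F (Region D.word → F) = D.word.length / 2 + 2 := by
    rw [Module.finrank_fintype_fun_eq_card, ← Nat.card_eq_fintype_card, D.planar]
  have h1 := LinearMap.finrank_le_finrank_of_injective hL
  have h2 := finrank_alternating_le (F := F) D.gauss
  have h3 : Module.finrank F (Region D.word → F) = Module.finrank F (alternating F D.word × F) := by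
    rw [Module.finrank_prod, Module.finrank_self] at h1 ⊢
    omega
  have hsurj : Function.Surjective L :=
    (LinearMap.injective_iff_surjective_of_finrank_eq_finrank h3).1 hL
  obtain ⟨C, hC⟩ := hsurj (⟨a, ha⟩, r)
  exact ⟨C, fun u => congrFun (congrArg (fun z => (Subtype.val (Prod.fst z))) hC) u,
    congrArg Prod.snd hC⟩

/-- In a planar diagram, sums of colors that fit together come from a coloring. -/
theorem exists_colorWalk_of_fox (D : KnotDiagram) {o l : ℕ → F} {a : F} (r : F)
    (H : Walk (foxIn o l) (foxOut o l) D.word a a) :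
    ∃ f : ℕ → Corners F, (∀ n, (f n).Balanced) ∧ ColorWalk f D.word (a - r, r) (a - r, r) ∧
      ∀ x ∈ D.word, (f x.crossing).x₁ + (f x.crossing).x₃ = o x.crossing ∧
        (f x.crossing).x₃ + (f x.crossing).x₄ = l x.crossing := by
  obtain ⟨τ, h0, hl, hτ⟩ := H.exists_states
  have hτj : ∀ j i, IsCrossing D.word j i →
      τ j.castSucc = o (D.word.get j).crossing ∧ τ j.succ = o (D.word.get j).crossing := by
    intro j i h
    rw [(hτ j).1, (hτ j).2]
    simp only [foxIn, foxOut, h.1, if_true, and_self]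
  have hτi : ∀ j i, IsCrossing D.word j i → τ i.castSucc = (if (D.word.get i).isPositive then
      l (D.word.get j).crossing else 2 * o (D.word.get j).crossing - l (D.word.get j).crossing) ∧
      τ i.succ = (if (D.word.get i).isPositive then
      2 * o (D.word.get j).crossing - l (D.word.get j).crossing else l (D.word.get j).crossing) := by
    intro j i h
    have ho := h.under_isOver
    have hc := h.crossing_eq
    rw [(hτ i).1, (hτ i).2]
    simp only [foxIn, foxOut, ho, hc, Bool.false_eq_true, if_false, and_self]
  -- The sums are alternating because `o + o = l + (2 * o - l)`.
  obtain ⟨C, hC, hr⟩ := exists_region_colors D (a := τ) ⟨hl.trans h0.symm, fun j i h => by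
    rw [(hτj j i h).1, (hτj j i h).2, (hτi j i h).1, (hτi j i h).2]
    split_ifs <;> ring⟩ r
  obtain ⟨f, hf1, hf2, hf3⟩ := exists_corners D.gauss C
  have hC0 := hC 0
  rw [h0, hr] at hC0
  have hsum : ∀ j i, IsCrossing D.word j i →
      (cornersAt C j).x₁ + (cornersAt C j).x₃ = o (D.word.get j).crossing ∧
      (cornersAt C j).x₂ + (cornersAt C j).x₄ = o (D.word.get j).crossing ∧
      (cornersAt C j).x₃ + (cornersAt C j).x₄ = l (D.word.get j).crossing := by
    intro j i h
    refine ⟨(hC _).trans (hτj j i h).1, (hC _).trans (hτj j i h).2, ?_⟩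
    obtain ⟨e1, e2⟩ := cornersAt_under C h
    obtain ⟨t1, t2⟩ := hτi j i h
    have c1 := hC i.castSucc
    have c2 := hC i.succ
    have ho := h.under_isOver
    unfold Corners.entry at e1
    unfold Corners.exit at e2
    rw [ho] at e1 e2
    simp only [Bool.false_eq_true, if_false] at e1 e2
    split_ifs at e1 e2 t1 t2 <;> simp only [Prod.mk.injEq] at e1 e2 <;> grind
  refine ⟨f, fun n => ?_, ?_, fun x hx => ?_⟩
  · rcases hf1 n with h | ⟨j, i, h, h'⟩
    · rw [h]; simp [Corners.Balanced]
    · rw [h']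
      exact (hsum j i h).1.trans (hsum j i h).2.1.symm
  · rw [hr, show C (region 0 .left) = a - r by rw [← hC0]; ring] at hf3
    exact hf3
  · obtain ⟨k, rfl⟩ := List.get_of_mem hx
    obtain ⟨k', ⟨hk, -⟩ | ⟨hk, -⟩⟩ := isCrossing_or D.gauss k
    · rw [hf2 k k' hk]
      exact ⟨(hsum k k' hk).1, (hsum k k' hk).2.2⟩
    · have := hk.crossing_eq
      rw [this, hf2 k' k hk]
      exact ⟨(hsum k' k hk).1, (hsum k' k hk).2.2⟩

end Planar

/-! ### Invariance of colorings of weight zero -/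

section Invariance

variable {p : ℕ} [Fact p.Prime] {h : ZMod p → ℤ}

/-- The new corners must match the regions on both strands, which an arbitrary Gauss word need not
allow. So the sums beside the semiarcs are extended first, and planarity of `D` turns them into a
coloring with the prescribed initial state. -/
theorem HasZero.insert_bigon (hh : IsLift h) {x y : Pass} {u v z : List Pass}
    (D : KnotDiagram) (hD : D.word = [x, y] ++ u ++ z ++ v)
    (ho : x.isOver = y.isOver) (hs : x.isPositive ≠ y.isPositive)
    (hz : z = [x.other, y.other] ∨ z = [y.other, x.other])
    (H : HasZero h (u ++ v)) : HasZero h D.word := by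
  obtain ⟨f, hf, ⟨s, hw⟩, ⟨b, hb, hb'⟩, h0⟩ := H
  have hG := D.gauss
  rw [hD] at hG
  obtain ⟨o, l, hfox, hsum⟩ := exists_fox_bigon hG hf ho hs hz hw
  rw [← hD] at hfox
  obtain ⟨g, hg, hgw, hgsum⟩ := exists_colorWalk_of_fox D s.2 hfox
  have hs' : (s.1 + s.2 - s.2, s.2) = s := by simp
  rw [hs'] at hgw
  have hmem : ∀ a ∈ u ++ v, a ∈ D.word := by
    intro a ha
    rw [hD]
    simp only [List.mem_append] at ha ⊢
    tauto
  have hp : p ≠ 0 := (Fact.out : p.Prime).ne_zero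
  rw [hD] at hgw
  obtain ⟨k1, k2, -⟩ := _root_.remove_bigon hp hh hg ho hs hz hgw
  -- The coloring `g` obtained from planarity is unrelated to `f` a priori; equal sums and equal
  -- initial states force agreement at the old crossings.
  obtain ⟨hfg, -⟩ := eq_of_colorWalk hf hg hw k1
    (fun a ha => (hsum a ha).1.trans (hgsum a (hmem a ha)).1.symm)
    (fun a ha => (hsum a ha).2.trans (hgsum a (hmem a ha)).2.symm)
  refine ⟨g, hg, ⟨s, by rwa [hD]⟩, ⟨b, hmem b hb, by rwa [← hfg b hb]⟩, ?_⟩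
  rw [hD, ← k2, ← wordWeight_congr h hfg, h0]

/-- The existence of a nontrivial coloring of weight zero is invariant under the moves. -/
theorem Move.hasZero_iff (hh : IsLift h) {D D' : KnotDiagram} (H : Move D.word D'.word) :
    HasZero h D.word ↔ HasZero h D'.word := by
  have hp : p ≠ 0 := (Fact.out : p.Prime).ne_zero
  have hG := D.gauss
  have hG' := D'.gauss
  generalize hw : D.word = w at H hG
  generalize hw' : D'.word = w' at H hG'
  cases H with
  | rotate u v => exact ⟨HasZero.rotate, HasZero.rotate⟩
  | relabel e w => exact (hasZero_relabel e w).symm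
  | reverse w => exact ⟨HasZero.reverse hp hh, fun H => by simpa using H.reverse hp hh⟩
  | r1 x w => exact (hasZero_r1 hG').symm
  | r2_direct x y u v ho hs =>
    refine ⟨fun H => ?_, HasZero.remove_bigon hp hh ho hs (Or.inl rfl)⟩
    rw [← hw']
    exact HasZero.insert_bigon hh D' hw' ho hs (Or.inl rfl) H
  | r2_opposite x y u v ho hs =>
    refine ⟨fun H => ?_, HasZero.remove_bigon hp hh ho hs (Or.inr rfl)⟩
    rw [← hw']
    exact HasZero.insert_bigon hh D' hw' ho hs (Or.inr rfl) H
  | r3_tml a b c t m l k u v w =>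
    -- A move of type III is inverted by a move of type III: the orders `!t`, `!m`, `!l` with `!k`
    -- give the same signs.
    have hk : ∀ x y : Bool, (x == y) = ((!x) == !y) := by decide
    refine ⟨HasZero.r3_tml hp hh rfl rfl rfl hG, fun H => ?_⟩
    have := HasZero.r3_tml hp hh (k := !k) (hk k l) (hk k m) (hk k t) hG' H
    simpa only [Bool.not_not] using this
  | r3_tlm a b c t m l k u v w =>
    have hk : ∀ x y : Bool, (x == y) = ((!x) == !y) := by decide
    refine ⟨HasZero.r3_tlm hp hh rfl rfl rfl hG, fun H => ?_⟩
    have := HasZero.r3_tlm hp hh (k := !k) (hk k l) (hk k m) (hk k t) hG' H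
    simpa only [Bool.not_not] using this

/-- All intermediate words of a chain of moves belong to a `KnotDiagram`, so planarity is available
at each step. -/
theorem hasZero_iff_of_isDiagramOf (hh : IsLift h) {D D' : KnotDiagram} {K : Knot}
    (hD : D.IsDiagramOf K) (hD' : D'.IsDiagramOf K) : HasZero h D.word ↔ HasZero h D'.word := by
  have := Quot.eqvGen_exact (hD.trans hD'.symm)
  induction this with
  | rel _ _ H => exact Move.hasZero_iff hh H
  | refl => rfl
  | symm _ _ _ ih => exact (ih hD' hD).symm
  | trans _ E _ h1 h2 ih1 ih2 =>
    have hE : E.IsDiagramOf K := (Quot.eqvGen_sound h1).symm.trans hD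
    exact (ih1 hD hE).trans (ih2 hE hD')

end Invariance


/-! ### Shadow colorings from colors of corners -/

section Mochizuki

variable {p : ℕ} [Fact p.Prime]

/-- The `p`-th powers of the representatives of residue classes. -/
def powLift (p : ℕ) (v : ZMod p) : ℤ := (v.val : ℤ) ^ p

/-- By Fermat's little theorem. Mochizuki's fraction can thus be compared with defects for any other
choice of representatives. -/
theorem powLift_isLift : IsLift (powLift p) := by
  intro a
  simp [powLift, ZMod.pow_card]

/-- Mochizuki's cocycle in terms of the `p`-th powers of representatives. -/
theorem mochizuki_eq (x y z : ZMod p) :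
    ∃ e : ℤ, powLift p (2 * z - y) + powLift p y - 2 * powLift p z = p * e ∧
      mochizuki p x y z = (x - y) * (e : ZMod p) := by
  have hp : (p : ℤ) ≠ 0 := by exact_mod_cast (Fact.out : p.Prime).ne_zero
  set m : ℤ := 2 * (z.val : ℤ) - y.val with hm
  have hcast : (((2 * z - y).val : ℤ) : ZMod p) = (m : ZMod p) := by
    simp [hm]
  have h1 : (p : ℤ) ∣ ((2 * z - y).val : ℤ) - m :=
    (ZMod.intCast_zmod_eq_zero_iff_dvd _ p).1 (by push_cast; rw [← hcast]; push_cast; ring)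
  -- Congruence modulo `p` improves to congruence modulo `p ^ 2` for `p`-th powers, so passing from
  -- `m` to the representative of `2 * z - y` changes the fraction by a multiple of `p` only.
  have h2 : (p : ℤ) ^ 2 ∣ ((2 * z - y).val : ℤ) ^ p - m ^ p := by
    have := dvd_sub_pow_of_dvd_sub h1 1
    simpa using this
  obtain ⟨c, hc⟩ := h2
  have h3 : (p : ℤ) ∣ m ^ p + (y.val : ℤ) ^ p - 2 * (z.val : ℤ) ^ p := by
    refine (ZMod.intCast_zmod_eq_zero_iff_dvd _ p).1 ?_
    push_cast
    rw [ZMod.pow_card, ZMod.pow_card, ZMod.pow_card, ← hcast]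
    simp
  obtain ⟨d, hd⟩ := h3
  refine ⟨p * c + d, ?_, ?_⟩
  · simp only [powLift]
    linear_combination hc + hd
  · have : mochizuki p x y z = (x - y) *
        ((((2 * (z.val : ℤ) - y.val) ^ p + (y.val : ℤ) ^ p - 2 * (z.val : ℤ) ^ p) / p : ℤ) : ZMod p) :=
      rfl
    rw [this, ← hm, hd, Int.mul_ediv_cancel_left _ hp]
    simp

/-- The failure of the representatives to be additive beside a semiarc. -/
def stateDefect (h : ZMod p → ℤ) (s : ZMod p × ZMod p) : ℤ :=
  (h s.1 + h s.2 - 2 * powLift p ((s.1 + s.2) * 2⁻¹)) / p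

/-- A function of the colors beside a semiarc which relates the two kinds of weights. -/
def statePotential (h : ZMod p → ℤ) (s : ZMod p × ZMod p) : ZMod p :=
  stateDefect h s * (s.2 - s.1)

theorem two_ne_zero_of_lt (h2 : 2 < p) : (2 : ZMod p) ≠ 0 := by
  have : ((2 : ℕ) : ZMod p) ≠ 0 := by
    rw [Ne, ZMod.natCast_eq_zero_iff]
    exact fun h => absurd (Nat.le_of_dvd (by norm_num) h) (by omega)
  exact_mod_cast this

theorem mul_stateDefect (h2 : 2 < p) {h : ZMod p → ℤ} (hh : IsLift h) (s : ZMod p × ZMod p) :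
    (p : ℤ) * stateDefect h s = h s.1 + h s.2 - 2 * powLift p ((s.1 + s.2) * 2⁻¹) := by
  refine Int.mul_ediv_cancel' ((ZMod.intCast_zmod_eq_zero_iff_dvd _ p).1 ?_)
  push_cast
  rw [hh, hh, powLift_isLift]
  field_simp [two_ne_zero_of_lt h2]
  ring

/-- The contribution of a crossing to the weight of a shadow coloring. -/
def Corners.shadowWeight (q : Corners (ZMod p)) (pos : Bool) : ZMod p :=
  if pos then mochizuki p q.x₄ ((q.x₃ + q.x₄) * 2⁻¹ : ZMod p) ((q.x₁ + q.x₃) * 2⁻¹ : ZMod p)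
  else -mochizuki p q.x₃ ((q.x₃ + q.x₄) * 2⁻¹ : ZMod p) ((q.x₁ + q.x₃) * 2⁻¹ : ZMod p)

/-- `stateDefect` measures `h` beside a semiarc against `powLift` at the color of the arc. Both
Mochizuki's fraction and the defect of the crossing are combinations of the four state defects
around it; after their elimination only potential differences along the two strands and the weight
remain. -/
theorem Corners.shadowWeight_eq (h2 : 2 < p) {h : ZMod p → ℤ} (hh : IsLift h)
    {q : Corners (ZMod p)} (hq : q.Balanced) {x : Pass} (hx : x.isOver = true) :
    4 * q.shadowWeight x.isPositive =
      (statePotential h (q.exit x) - statePotential h (q.entry x)) +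
      (statePotential h (q.exit x.other) - statePotential h (q.entry x.other)) - q.weight h := by
  have two := two_ne_zero_of_lt h2
  have hp : (p : ℤ) ≠ 0 := by exact_mod_cast (Fact.out : p.Prime).ne_zero
  have hb : q.x₁ + q.x₃ = q.x₂ + q.x₄ := hq
  have hd := mul_defect hh hq
  have e13 := mul_stateDefect h2 hh (q.x₁, q.x₃)
  have e24 := mul_stateDefect h2 hh (q.x₂, q.x₄)
  have e12 := mul_stateDefect h2 hh (q.x₁, q.x₂)
  have e34 := mul_stateDefect h2 hh (q.x₃, q.x₄)
  have e21 : stateDefect h (q.x₂, q.x₁) = stateDefect h (q.x₁, q.x₂) := by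
    simp only [stateDefect, add_comm]
  have e43 : stateDefect h (q.x₄, q.x₃) = stateDefect h (q.x₃, q.x₄) := by
    simp only [stateDefect, add_comm]
  obtain ⟨e, he, -⟩ := mochizuki_eq 0 ((q.x₃ + q.x₄) * 2⁻¹) ((q.x₁ + q.x₃) * 2⁻¹)
  have hM : ∀ a : ZMod p, mochizuki p a ((q.x₃ + q.x₄) * 2⁻¹ : ZMod p)
      ((q.x₁ + q.x₃) * 2⁻¹ : ZMod p) = (a - (q.x₃ + q.x₄) * 2⁻¹) * (e : ZMod p) := by
    intro a
    obtain ⟨e', he', hm⟩ := mochizuki_eq a ((q.x₃ + q.x₄) * 2⁻¹) ((q.x₁ + q.x₃) * 2⁻¹)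
    rw [hm, mul_left_cancel₀ hp (he'.symm.trans he)]
  -- The reflected color is the half-sum beside the other half of the under-strand.
  have hz : 2 * ((q.x₁ + q.x₃) * 2⁻¹) - (q.x₃ + q.x₄) * 2⁻¹ = (q.x₁ + q.x₂) * 2⁻¹ := by
    field_simp
    linear_combination hb
  have hz' : (q.x₂ + q.x₄) * 2⁻¹ = (q.x₁ + q.x₃) * 2⁻¹ := by rw [hb]
  rw [hz] at he
  simp only [hz'] at e24
  simp only at e13 e12 e34
  have k1 : -2 * e = stateDefect h (q.x₁, q.x₂) + stateDefect h (q.x₃, q.x₄) -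
      stateDefect h (q.x₁, q.x₃) - stateDefect h (q.x₂, q.x₄) := by
    apply mul_left_cancel₀ hp
    linear_combination 2 * he - e12 - e34 + e13 + e24
  -- The `powLift` terms cancel because both halves of the over-strand have the same half-sum.
  have k2 : q.defect h = stateDefect h (q.x₁, q.x₃) - stateDefect h (q.x₂, q.x₄) := by
    apply mul_left_cancel₀ hp
    linear_combination hd - e13 + e24
  have k1' : -2 * (e : ZMod p) = stateDefect h (q.x₁, q.x₂) + stateDefect h (q.x₃, q.x₄) -
      stateDefect h (q.x₁, q.x₃) - stateDefect h (q.x₂, q.x₄) := by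
    exact_mod_cast congrArg (Int.cast (R := ZMod p)) k1
  have hinv : (2 : ZMod p) * 2⁻¹ = 1 := mul_inv_cancel₀ two
  have hb2 : q.x₂ = q.x₁ + q.x₃ - q.x₄ := by linear_combination -hb
  unfold weight shadowWeight
  rw [k2, hM, hM]
  cases hs : x.isPositive
  · simp only [entry, exit, hx, Pass.other_isOver, Pass.other_isPositive, hs, statePotential, e21,
      e43, Bool.not_true, Bool.false_eq_true, if_true, if_false]
    push_cast
    generalize (stateDefect h (q.x₁, q.x₂) : ZMod p) = d12 at *
    generalize (stateDefect h (q.x₃, q.x₄) : ZMod p) = d34 at *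
    generalize (stateDefect h (q.x₁, q.x₃) : ZMod p) = d13 at *
    generalize (stateDefect h (q.x₂, q.x₄) : ZMod p) = d24 at *
    rw [hb2]
    linear_combination (q.x₃ - q.x₄) * k1' + 2 * (q.x₃ + q.x₄) * (e : ZMod p) * hinv
  · simp only [entry, exit, hx, Pass.other_isOver, Pass.other_isPositive, hs, statePotential,
      Bool.not_true, Bool.false_eq_true, if_true, if_false]
    push_cast
    generalize (stateDefect h (q.x₁, q.x₂) : ZMod p) = d12 at *
    generalize (stateDefect h (q.x₃, q.x₄) : ZMod p) = d34 at *
    generalize (stateDefect h (q.x₁, q.x₃) : ZMod p) = d13 at *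
    generalize (stateDefect h (q.x₂, q.x₄) : ZMod p) = d24 at *
    rw [hb2]
    linear_combination (q.x₃ - q.x₄) * k1' - 2 * (q.x₃ + q.x₄) * (e : ZMod p) * hinv

/-- The weights of shadow colorings are proportional to the weights of colorings. -/
theorem sum_shadowWeight (h2 : 2 < p) {h : ZMod p → ℤ} (hh : IsLift h) {w : List Pass}
    (hw : IsGaussCode w) {f : ℕ → Corners (ZMod p)} (hf : ∀ n, (f n).Balanced)
    {s : ZMod p × ZMod p} (hs : ColorWalk f w s s) :
    4 * (w.map fun x => if x.isOver then (f x.crossing).shadowWeight x.isPositive else 0).sum =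
      -wordWeight h f w := by
  -- The potential differences cancel around the closed walk.
  have k1 := hs.sum_sub (statePotential h)
  rw [sub_self, hw.sum_eq] at k1
  have k2 : (w.map fun x => if x.isOver then (f x.crossing).shadowWeight x.isPositive else 0).sum =
      ((w.filter (·.isOver)).map fun x => (f x.crossing).shadowWeight x.isPositive).sum := by
    clear hs hw k1
    induction w with
    | nil => simp
    | cons x w ih => cases hx : x.isOver <;> simp [hx, ih]
  apply eq_neg_of_add_eq_zero_left
  rw [k2, wordWeight_eq, ← List.sum_map_mul_left, ← List.sum_map_add, ← k1]
  congr 1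
  refine List.map_congr_left fun x hx => ?_
  rw [Corners.shadowWeight_eq h2 hh (hf _) (List.mem_filter.1 hx).2, sub_add_cancel]
  rfl

end Mochizuki

/-! ### From colors of corners back to colors of regions -/

section ShadowColoring

variable {w : List Pass} {R : Type*} {f : ℕ → Corners R} {σ : Semiarc w → R × R}

/-- The color beside a semiarc. -/
def sideColor (σ : Semiarc w → R × R) : Semiarc w × Side → R
  | (u, .left) => (σ u).1
  | (u, .right) => (σ u).2

/-- The converse of `exists_corners`: the states of a closed walk are compatible with all gluings of
sides and so descend to `Region w`. -/
theorem sideColor_adjoin (h0 : σ (Fin.last _) = σ 0)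
    (hσ : ∀ k, σ k.castSucc = (f (w.get k).crossing).entry (w.get k) ∧
      σ k.succ = (f (w.get k).crossing).exit (w.get k))
    {a b : Semiarc w × Side} (hab : Adjoin w a b) : sideColor σ a = sideColor σ b := by
  have key : ∀ j i, IsCrossing w j i →
      σ j.castSucc = ((f (w.get j).crossing).x₁, (f (w.get j).crossing).x₃) ∧
      σ j.succ = ((f (w.get j).crossing).x₂, (f (w.get j).crossing).x₄) ∧
      σ i.castSucc = (if (w.get j).isPositive then
        ((f (w.get j).crossing).x₃, (f (w.get j).crossing).x₄) else
        ((f (w.get j).crossing).x₂, (f (w.get j).crossing).x₁)) ∧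
      σ i.succ = (if (w.get j).isPositive then
        ((f (w.get j).crossing).x₁, (f (w.get j).crossing).x₂) else
        ((f (w.get j).crossing).x₄, (f (w.get j).crossing).x₃)) := by
    intro j i h
    have hi := h.under_isOver
    have hc := h.crossing_eq
    have hp : (w.get i).isPositive = (w.get j).isPositive := by rw [h.2]; rfl
    rw [(hσ j).1, (hσ j).2, (hσ i).1, (hσ i).2, hc]
    simp only [Corners.entry, Corners.exit, h.1, hi, hp, if_true, Bool.false_eq_true, if_false,
      and_self]
  cases hab with
  | cut s => cases s <;> simp [sideColor, h0]
  | _ j i h hs =>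
    obtain ⟨k1, k2, k3, k4⟩ := key j i h
    simp only [hs, if_true, Bool.false_eq_true, if_false] at k3 k4
    simp only [sideColor, k1, k2, k3, k4]

end ShadowColoring

section

variable {p : ℕ} [Fact p.Prime]

/-- Regions keep their colors and each arc gets the mean of the colors on its two sides, so that
crossing an arc is reflection in its color. The lift `h` is arbitrary, since the shadow weight does
not involve it. -/
theorem zero_mem_of_hasZero (h2 : 2 < p) {h : ZMod p → ℤ} (hh : IsLift h) {D : KnotDiagram}
    (H : HasZero h D.word) : (0 : ZMod p) ∈ shadowCocycleInvariantNT (mochizuki p) D := by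
  have two := two_ne_zero_of_lt h2
  have hinv : (2 : ZMod p) * 2⁻¹ = 1 := mul_inv_cancel₀ two
  obtain ⟨f, hf, ⟨s, hs⟩, ⟨x, hx, hx'⟩, h0⟩ := H
  obtain ⟨σ, hσ0, hσl, hσ⟩ := hs.exists_states
  have hcut : σ (Fin.last _) = σ 0 := hσl.trans hσ0.symm
  have hb : ∀ n, (f n).x₁ + (f n).x₃ = (f n).x₂ + (f n).x₄ := hf
  have hj : ∀ j i, IsCrossing D.word j i →
      σ j.castSucc = ((f (D.word.get j).crossing).x₁, (f (D.word.get j).crossing).x₃) ∧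
      σ j.succ = ((f (D.word.get j).crossing).x₂, (f (D.word.get j).crossing).x₄) := by
    intro j i h
    rw [(hσ j).1, (hσ j).2]
    simp only [Corners.entry, Corners.exit, h.1, if_true, and_self]
  have hi : ∀ j i, IsCrossing D.word j i →
      (σ (sourceUnder i)).1 + (σ (sourceUnder i)).2 =
        (f (D.word.get j).crossing).x₃ + (f (D.word.get j).crossing).x₄ ∧
      (σ (targetUnder i)).1 + (σ (targetUnder i)).2 =
        (f (D.word.get j).crossing).x₁ + (f (D.word.get j).crossing).x₂ ∧
      (σ (sourceUnder i)).2 = if (D.word.get j).isPositive then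
        (f (D.word.get j).crossing).x₄ else (f (D.word.get j).crossing).x₃ := by
    intro j i h
    have hi := h.under_isOver
    have hc := h.crossing_eq
    have hp : (D.word.get i).isPositive = (D.word.get j).isPositive := by rw [h.2]; rfl
    unfold sourceUnder targetUnder
    rw [hp]
    cases hs : (D.word.get j).isPositive <;>
    · simp only [Bool.false_eq_true, if_false, if_true]
      rw [(hσ i).1, (hσ i).2, hc]
      simp only [Corners.entry, Corners.exit, hi, hp, hs, if_true, Bool.false_eq_true, if_false]
      refine ⟨?_, ?_, ?_⟩ <;> first | trivial | ring
  have hAcut : ((σ (Fin.last _)).1 + (σ (Fin.last _)).2) * 2⁻¹ = ((σ 0).1 + (σ 0).2) * 2⁻¹ := by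
    rw [hcut]
  have hAover : ∀ j i, IsCrossing D.word j i →
      ((σ j.castSucc).1 + (σ j.castSucc).2) * 2⁻¹ = ((σ j.succ).1 + (σ j.succ).2) * 2⁻¹ :=
    fun j i h => by rw [(hj j i h).1, (hj j i h).2, hb (D.word.get j).crossing]
  let S : ShadowColoring (Quandle.Dihedral p) D :=
    { arc := fun u => (((σ u).1 + (σ u).2) * 2⁻¹ : ZMod p)
      reg := Quot.lift (sideColor σ) fun a b hab => sideColor_adjoin hcut hσ hab
      arc_cut := hAcut
      arc_over := hAover
      arc_under := fun j i h => by
        change ((σ (targetUnder i)).1 + (σ (targetUnder i)).2) * 2⁻¹ =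
          2 * (((σ j.castSucc).1 + (σ j.castSucc).2) * 2⁻¹) -
            ((σ (sourceUnder i)).1 + (σ (sourceUnder i)).2) * 2⁻¹
        rw [(hi j i h).1, (hi j i h).2.1, (hj j i h).1]
        linear_combination -2⁻¹ * hb (D.word.get j).crossing
      reg_semiarc := fun u => by
        change (σ u).1 = 2 * (((σ u).1 + (σ u).2) * 2⁻¹) - (σ u).2
        linear_combination -((σ u).1 + (σ u).2) * hinv }
  unfold shadowCocycleInvariantNT
  simp only [Multiset.mem_map, Finset.mem_val, Finset.mem_filter]
  refine ⟨S, ⟨@Finset.mem_univ _ (_) _, ?_⟩, ?_⟩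
  -- If all arcs had the same color, then `x₁ + x₃ = x₃ + x₄ = x₁ + x₂` at every crossing, so every
  -- crossing would be trivially colored.
  · by_contra hcon
    have hall : ∀ u v, S.arc u = S.arc v := by
      intro u v
      by_contra h
      exact hcon ⟨u, v, h⟩
    have hsum : ∀ u v, (σ u).1 + (σ u).2 = (σ v).1 + (σ v).2 := by
      intro u v
      have : ((σ u).1 + (σ u).2) * 2⁻¹ = ((σ v).1 + (σ v).2) * (2⁻¹ : ZMod p) := hall u v
      exact mul_right_cancel₀ (inv_ne_zero two) this
    apply hx'
    obtain ⟨k, rfl⟩ := List.get_of_mem hx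
    obtain ⟨j, i, hji, hc⟩ : ∃ j i, IsCrossing D.word j i ∧
        (D.word.get k).crossing = (D.word.get j).crossing := by
      obtain ⟨k', ⟨hk, -⟩ | ⟨hk, -⟩⟩ := isCrossing_or D.gauss k
      · exact ⟨k, k', hk, rfl⟩
      · exact ⟨k', k, hk, hk.crossing_eq⟩
    rw [hc]
    have e1 := hsum (sourceUnder i) j.castSucc
    have e2 := hsum (targetUnder i) j.castSucc
    rw [(hi j i hji).1, (hj j i hji).1] at e1
    rw [(hi j i hji).2.1, (hj j i hji).1] at e2
    simp only at e1 e2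
    constructor
    · linear_combination -e1
    · linear_combination -e2
  · have hweight : ShadowColoring.weight (mochizuki p) S = (D.word.map fun x =>
        if x.isOver then (f x.crossing).shadowWeight x.isPositive else 0).sum := by
      unfold ShadowColoring.weight
      rw [← Fin.sum_univ_fun_getElem]
      refine Finset.sum_congr rfl fun j _ => ?_
      change _ = if (D.word.get j).isOver then
        (f (D.word.get j).crossing).shadowWeight (D.word.get j).isPositive else 0
      obtain ⟨i, ⟨hk, ho⟩ | ⟨hk, ho⟩⟩ := isCrossing_or D.gauss j
      · rw [Finset.sum_eq_single i, if_pos hk, if_pos ho]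
        · change (if (D.word.get j).isPositive then (1 : ℤ) else -1) •
            mochizuki p (σ (sourceUnder i)).2
              (((σ (sourceUnder i)).1 + (σ (sourceUnder i)).2) * 2⁻¹ : ZMod p)
              (((σ j.castSucc).1 + (σ j.castSucc).2) * 2⁻¹ : ZMod p) = _
          rw [(hi j i hk).1, (hi j i hk).2.2, (hj j i hk).1]
          unfold Corners.shadowWeight
          cases (D.word.get j).isPositive <;> simp
        · intro i' _ hne
          rw [if_neg]
          exact fun h => hne (h.unique D.gauss hk rfl).2
        · simp
      · rw [ho]
        simp only [Bool.false_eq_true, if_false]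
        refine Finset.sum_eq_zero fun i' _ => if_neg fun h => ?_
        rw [h.1] at ho
        exact absurd ho (by simp)
    have := sum_shadowWeight h2 hh D.gauss hf hs
    rw [h0, neg_zero, ← hweight] at this
    have four : (4 : ZMod p) ≠ 0 := by
      rw [show (4 : ZMod p) = 2 * 2 by norm_num]
      exact mul_ne_zero two two
    exact (mul_eq_zero.1 this).resolve_left four

end


/-! ### Sets of colors for which all colorings have weight zero -/

variable {p : ℕ}

/-- On quadruples of colors in `S` the weight is the sum along the boundary of a square of an
antisymmetric function. -/
def Tame (S : Set (ZMod p)) : Prop :=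
  ∃ h : ZMod p → ℤ, IsLift h ∧ ∃ φ : ZMod p → ZMod p → ZMod p, (∀ a b, φ a b = -φ b a) ∧
    ∀ q : Corners (ZMod p), q.Balanced → q.x₁ ∈ S → q.x₂ ∈ S → q.x₃ ∈ S → q.x₄ ∈ S →
      φ q.x₁ q.x₃ + φ q.x₃ q.x₄ + φ q.x₄ q.x₂ + φ q.x₂ q.x₁ = q.weight h

theorem Tame.mono {S T : Set (ZMod p)} (hST : S ⊆ T) (hT : Tame T) : Tame S := by
  obtain ⟨h, hh, φ, hφ, H⟩ := hT
  exact ⟨h, hh, φ, hφ, fun q hq h1 h2 h3 h4 => H q hq (hST h1) (hST h2) (hST h3) (hST h4)⟩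

/-- Pull `h` back along `x ↦ a x + b` and correct it by integers over `a⁻¹` and `-b a⁻¹` to obtain a
lift again. Defects are multiplied by the integer over `a⁻¹`, and weights by `a⁻¹ ^ 2`. -/
theorem Tame.of_affine [Fact p.Prime] {S T : Set (ZMod p)} {a b : ZMod p} (ha : a ≠ 0)
    (hST : ∀ x ∈ S, a * x + b ∈ T) (hT : Tame T) : Tame S := by
  obtain ⟨h, hh, φ, hφ, H⟩ := hT
  have hp : (p : ℤ) ≠ 0 := by exact_mod_cast (Fact.out : p.Prime).ne_zero
  have hinv : a * a⁻¹ = 1 := mul_inv_cancel₀ ha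
  set μ : ℤ := ((a⁻¹).val : ℤ) with hμ
  have hμ' : (μ : ZMod p) = a⁻¹ := by simp [hμ]
  set ν : ℤ := ((-b * a⁻¹).val : ℤ) with hν
  have hν' : (ν : ZMod p) = -b * a⁻¹ := by simp [hν]
  have hl : IsLift fun x => μ * h (a * x + b) + ν := by
    intro x
    push_cast
    rw [hh, hμ', hν']
    linear_combination x * hinv
  refine ⟨_, hl, fun x y => a⁻¹ ^ 2 * φ (a * x + b) (a * y + b), fun x y => ?_, ?_⟩
  · change a⁻¹ ^ 2 * φ (a * x + b) (a * y + b) = -(a⁻¹ ^ 2 * φ (a * y + b) (a * x + b))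
    rw [hφ]; ring
  · intro q hq h1 h2 h3 h4
    set r : Corners (ZMod p) := ⟨a * q.x₁ + b, a * q.x₂ + b, a * q.x₃ + b, a * q.x₄ + b⟩ with hr
    have hq' : q.x₁ + q.x₃ = q.x₂ + q.x₄ := hq
    have hrb : r.Balanced := by
      change a * q.x₁ + b + (a * q.x₃ + b) = a * q.x₂ + b + (a * q.x₄ + b)
      linear_combination a * hq'
    have key := H r hrb (hST _ h1) (hST _ h2) (hST _ h3) (hST _ h4)
    have e1 := Corners.mul_defect hl hq
    have e2 := Corners.mul_defect hh hrb
    have e3 : q.defect (fun x => μ * h (a * x + b) + ν) = μ * r.defect h := by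
      apply mul_left_cancel₀ hp
      rw [e1]
      linear_combination -μ * e2
    unfold Corners.weight at key ⊢
    rw [e3]
    push_cast
    rw [hμ']
    simp only [hr] at key ⊢
    linear_combination a⁻¹ ^ 2 * key + (q.x₁ - q.x₄) * a⁻¹ * (r.defect h : ZMod p) * hinv

/-- Colorings with tame colors have weight zero. -/
theorem wordWeight_eq_zero {w : List Pass} (hw : IsGaussCode w) {f : ℕ → Corners (ZMod p)}
    {s : ZMod p × ZMod p} (hs : ColorWalk f w s s) {h : ZMod p → ℤ} {φ : ZMod p → ZMod p → ZMod p}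
    (hφ : ∀ a b, φ a b = -φ b a)
    (H : ∀ x ∈ w, φ (f x.crossing).x₁ (f x.crossing).x₃ + φ (f x.crossing).x₃ (f x.crossing).x₄ +
      φ (f x.crossing).x₄ (f x.crossing).x₂ + φ (f x.crossing).x₂ (f x.crossing).x₁ =
        (f x.crossing).weight h) : wordWeight h f w = 0 := by
  -- Take `φ` of the colors to the left and right as a potential on semiarcs. By antisymmetry its
  -- change along both strands of a crossing is minus the boundary sum, for either sign of the
  -- crossing.
  have k := hs.sum_sub fun a => φ a.1 a.2
  rw [sub_self, hw.sum_eq] at k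
  have k' := congrArg (wordWeight h f w + ·) k
  simp only [add_zero] at k'
  rw [← k', wordWeight_eq, ← List.sum_map_add]
  refine List.sum_eq_zero fun a ha => ?_
  obtain ⟨x, hx, rfl⟩ := List.mem_map.1 ha
  obtain ⟨hx, ho⟩ := List.mem_filter.1 hx
  have e1 := hφ (f x.crossing).x₄ (f x.crossing).x₂
  have e2 := hφ (f x.crossing).x₂ (f x.crossing).x₁
  have e3 := hφ (f x.crossing).x₃ (f x.crossing).x₄
  rw [← H x hx]
  cases hp : x.isPositive <;>
  · simp only [Corners.entry, Corners.exit, ho, hp, Pass.other_isOver, Pass.other_isPositive,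
      Pass.other_crossing, if_true, Bool.not_true, Bool.false_eq_true, if_false]
    first | linear_combination e1 + e2 | linear_combination e1 + e3

/-- The standard representatives. -/
def valLift (p : ℕ) (x : ZMod p) : ℤ := x.val

theorem valLift_isLift [NeZero p] : IsLift (valLift p) := fun x => by simp [valLift]

/-- Both sums of two numbers are below `p`, so a multiple of `p` that is their difference must be
zero. -/
theorem eq_zero_of_half {d : ℤ} {a b c e : ℕ} (ha : 2 * a < p) (hb : 2 * b < p) (hc : 2 * c < p)
    (he : 2 * e < p) (h : (p : ℤ) * d = a + b - c - e) : d = 0 := by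
  by_contra hne
  rcases lt_or_gt_of_ne hne with hlt | hgt
  · have : (p : ℤ) * d ≤ (p : ℤ) * (-1) := mul_le_mul_of_nonneg_left (by omega) (by omega)
    omega
  · have : (p : ℤ) * 1 ≤ (p : ℤ) * d := mul_le_mul_of_nonneg_left (by omega) (by omega)
    omega

theorem tame_of_half [NeZero p] {S : Set (ZMod p)} (hS : ∀ x ∈ S, 2 * x.val < p) : Tame S := by
  refine ⟨valLift p, valLift_isLift, fun _ _ => 0, by simp, fun q hq h1 h2 h3 h4 => ?_⟩
  have hd := eq_zero_of_half (hS _ h1) (hS _ h3) (hS _ h2) (hS _ h4)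
    (Corners.mul_defect valLift_isLift hq)
  simp [Corners.weight, hd]

/-- A set is tame if all but one of its elements are in the lower half of the residues and a function
with certain differences exists. -/
theorem tame_of_star [NeZero p] {S : Set (ZMod p)} {m : ZMod p}
    (hS : ∀ x ∈ S, x ≠ m → 2 * x.val < p) (ψ : ZMod p → ZMod p)
    (h1 : ∀ x z w, x ∈ S → z ∈ S → w ∈ S → x ≠ m → z ≠ m → w ≠ m → ∀ d : ℤ,
      (p : ℤ) * d = m.val + x.val - z.val - w.val → ψ x - ψ z = (m - w) * d)
    (h2 : ∀ z w, z ∈ S → w ∈ S → z ≠ m → w ≠ m → ∀ d : ℤ,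
      (p : ℤ) * d = m.val + m.val - z.val - w.val → ψ w - ψ z = (m - w) * d) : Tame S := by
  classical
  -- A function supported on the pairs with exactly one entry `m`. The hypotheses on `ψ` are the
  -- boundary condition for one corner `m` and for two opposite corners `m`; the other positions
  -- follow by symmetry.
  set φ : ZMod p → ZMod p → ZMod p := fun a b => if a = m then (if b = m then 0 else ψ b) else
    if b = m then -ψ a else 0 with hφ
  have φ0 : φ m m = 0 := by simp [hφ]
  have φ1 : ∀ b, b ≠ m → φ m b = ψ b := fun b hb => by simp [hφ, hb]
  have φ2 : ∀ a, a ≠ m → φ a m = -ψ a := fun a ha => by simp [hφ, ha]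
  have φ3 : ∀ a b, a ≠ m → b ≠ m → φ a b = 0 := fun a b ha hb => by simp [hφ, ha, hb]
  refine ⟨valLift p, valLift_isLift, φ, fun a b => ?_, fun q hq s1 s2 s3 s4 => ?_⟩
  · simp only [hφ]
    split_ifs <;> simp
  have e := Corners.mul_defect valLift_isLift hq
  unfold Corners.weight
  generalize q.defect (valLift p) = d at e
  have hb : q.x₁ + q.x₃ = q.x₂ + q.x₄ := hq
  obtain ⟨x₁, x₂, x₃, x₄⟩ := q
  simp only [valLift] at e hb s1 s2 s3 s4 ⊢
  clear hφ hq
  clear_value φ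
  have hp : (p : ℤ) ≠ 0 := by exact_mod_cast NeZero.ne p
  have hd0 : (p : ℤ) * d = 0 → d = 0 := fun h => (mul_eq_zero.1 h).resolve_left hp
  by_cases e1 : x₁ = m
  · subst e1
    by_cases e3 : x₃ = x₁
    · subst e3
      by_cases e2 : x₂ = x₃
      · obtain rfl : x₄ = x₃ := by subst e2; linear_combination -hb
        subst e2
        simp [φ0]
      · have e4 : x₄ ≠ x₃ := fun h => e2 (by subst h; linear_combination -hb)
        rw [φ0, φ1 _ e4, φ3 _ _ e4 e2, φ2 _ e2]
        linear_combination h2 x₂ x₄ s2 s4 e2 e4 d (by linear_combination e)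
    · by_cases e2 : x₂ = x₁
      · subst e2
        obtain rfl : x₃ = x₄ := by linear_combination hb
        have : d = 0 := hd0 (by linear_combination e)
        rw [φ0, φ1 _ e3, φ2 _ e3, φ3 _ _ e3 e3, this]
        simp
      · by_cases e4 : x₄ = x₁
        · subst e4
          obtain rfl : x₃ = x₂ := by linear_combination hb
          rw [φ1 _ e2, φ2 _ e2]
          ring
        · rw [φ1 _ e3, φ3 _ _ e3 e4, φ3 _ _ e4 e2, φ2 _ e2]
          linear_combination h1 x₃ x₂ x₄ s3 s2 s4 e3 e2 e4 d (by linear_combination e)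
  · by_cases e3 : x₃ = m
    · subst e3
      by_cases e2 : x₂ = x₃
      · subst e2
        obtain rfl : x₁ = x₄ := by linear_combination hb
        rw [φ1 _ e1, φ2 _ e1]
        ring
      · by_cases e4 : x₄ = x₃
        · subst e4
          obtain rfl : x₁ = x₂ := by linear_combination hb
          have : d = 0 := hd0 (by linear_combination e)
          rw [φ0, φ1 _ e1, φ2 _ e1, φ3 _ _ e1 e1, this]
          simp
        · rw [φ2 _ e1, φ1 _ e4, φ3 _ _ e4 e2, φ3 _ _ e2 e1]
          linear_combination -h1 x₁ x₄ x₂ s1 s4 s2 e1 e4 e2 d (by linear_combination e) - (d : ZMod p) * hb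
    · by_cases e2 : x₂ = m
      · subst e2
        by_cases e4 : x₄ = x₂
        · subst e4
          rw [φ3 _ _ e1 e3, φ2 _ e3, φ0, φ1 _ e1]
          have := h2 x₃ x₁ s3 s1 e3 e1 (-d) (by linear_combination -e)
          push_cast at this
          linear_combination this
        · rw [φ3 _ _ e1 e3, φ3 _ _ e3 e4, φ2 _ e4, φ1 _ e1]
          have := h1 x₄ x₁ x₃ s4 s1 s3 e4 e1 e3 (-d) (by linear_combination -e)
          push_cast at this
          linear_combination -this - (d : ZMod p) * hb
      · by_cases e4 : x₄ = m
        · subst e4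
          rw [φ3 _ _ e1 e3, φ2 _ e3, φ1 _ e2, φ3 _ _ e2 e1]
          have := h1 x₂ x₃ x₁ s2 s3 s1 e2 e3 e1 (-d) (by linear_combination -e)
          push_cast at this
          linear_combination this
        · rw [φ3 _ _ e1 e3, φ3 _ _ e3 e4, φ3 _ _ e4 e2, φ3 _ _ e2 e1,
            eq_zero_of_half (hS _ s1 e1) (hS _ s3 e3) (hS _ s2 e2) (hS _ s4 e4) e]
          simp


/-! ### A finite check of sets of colors -/

namespace Palette

/-- Application of a function to the normal form of a numeral. -/
def force {α : Type} (n : ℕ) (k : ℕ → α) : α := Nat.rec (k 0) (fun m _ => k (Nat.succ m)) n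

/-- For a residue `m` and residues in `T`, the differences `(x, z, d)` prescribed for a function on `T`:
if `m + x` is `z + w` or `z + w + p`, then the values at `x` and `z` differ by `0` or `m - w`. -/
def slopes (p m : ℕ) (T : List ℕ) : List (ℕ × ℕ × ℕ) :=
  T.flatMap fun z => T.flatMap fun w =>
    force (Nat.add z w) fun s =>
    T.foldr (fun x l =>
      bif Nat.beq (Nat.add m x) s then (x, z, 0) :: l
      else bif Nat.beq (Nat.add m x) (Nat.add s p) then
        force (Nat.sub (Nat.add m p) w) fun d => (x, z, d) :: l else l)
      (bif Nat.beq (Nat.add m m) s then [(w, z, 0)] else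
        bif Nat.beq (Nat.add m m) (Nat.add s p) then
          force (Nat.sub (Nat.add m p) w) fun d => [(w, z, d)] else [])

/-- The entry of an association list. -/
def lookup (v : ℕ) : List (ℕ × ℕ × ℕ) → ℕ × ℕ
  | [] => (0, 0)
  | e :: l => bif Nat.beq e.1 v then e.2 else lookup v l

/-- Merge the class `a` into the class `b`, with the offset `o`. -/
def shift (p a b o : ℕ) : List (ℕ × ℕ × ℕ) → List (ℕ × ℕ × ℕ)
  | [] => []
  | (y, r, u) :: l =>
    bif Nat.beq r a then force (Nat.mod (Nat.add u o) p) fun u => (y, b, u) :: shift p a b o l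
    else (y, r, u) :: shift p a b o l

/-- Find a function with prescribed differences. -/
def starSolve (p : ℕ) : List (ℕ × ℕ × ℕ) → List (ℕ × ℕ × ℕ) → List (ℕ × ℕ × ℕ)
  | [], l => l
  | (x, z, d) :: cs, l =>
    -- An entry `(v, c, u)` of the list says that `v` lies in the class `c` with value `u` relative
    -- to that class. A difference within a class is checked, one between two classes merges them.
    match lookup x l, lookup z l with
    | (a, u), (b, v) => bif Nat.beq a b then
       (bif Nat.beq u (Nat.mod (Nat.add v d) p) then starSolve p cs l else [])
       -- The offset `v + d - u`, with `p - u` for `-u`.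
       else force (Nat.add (Nat.add v d) (Nat.sub p u)) fun o => starSolve p cs (shift p a b o l)

/-- The differences prescribed by `slopes` are those of a function. -/
def starGood (p m : ℕ) (T : List ℕ) : Bool :=
  match slopes p m T with
  | cs => match starSolve p cs (T.map fun v => (v, v, 0)) with
  | [] => false
  | l => cs.all fun c => Nat.beq (lookup c.1 l).2 (Nat.mod (Nat.add (lookup c.2.1 l).2 c.2.2) p)

/-- The map `s ↦ a (s + t)` sends all elements of a list to the lower half of the residues, or all but
one, and then `starGood` holds. -/
def goodAt (p a t : ℕ) : List ℕ → List ℕ → List ℕ → Bool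
  | [], _, [] => true
  | [], T, [m] => starGood p m T
  | [], _, _ :: _ :: _ => false
  | s :: S, T, B => force (Nat.mod (Nat.mul a (Nat.add s t)) p) fun u =>
      bif Nat.blt (Nat.mul 2 u) p then goodAt p a t S (u :: T) B
      else match B with
      | [] => goodAt p a t S T [u]
      | _ :: _ => false

/-- A test whether `goodAt` holds for some affine map. -/
def good (p : ℕ) (S : List ℕ) : Bool :=
  -- The translation by `p - r` sends `r` to `0`. The search need not be exhaustive, because only
  -- its success is used.
  (List.range' 1 (p / 2)).any fun a => S.any fun r => force (Nat.sub p r) fun t => goodAt p a t S [] []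

/-- The residue `a` is in an arithmetic progression with two elements of `S`. -/
def inAP (p a : ℕ) (S : List ℕ) : Bool :=
  S.any fun b => S.any fun c => bif Nat.beq b c then false else
    Nat.beq (Nat.mod (Nat.add a b) p) (Nat.mod (Nat.add c c) p) ||
    Nat.beq (Nat.mod (Nat.add b c) p) (Nat.mod (Nat.add a a) p)

/-- The affine maps in `W` which send `a` to the lower half of the residues. -/
def win (p a : ℕ) : List (ℕ × ℕ) → List (ℕ × ℕ)
  | [] => []
  | c :: W => bif Nat.blt (Nat.mul 2 (Nat.mod (Nat.add (Nat.mul c.1 a) c.2) p)) p then c :: win p a W else win p a W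

/-- All sets obtained from `S` by adding `k` residues `≥ lo` (without arithmetic progressions if `free`
holds) are mapped to the lower half by an affine map, or satisfy `good`. -/
def allExtensions (p : ℕ) (free : Bool) : ℕ → ℕ → List ℕ → List (ℕ × ℕ) → Bool
  | 0, _, S, W => match W with
     | [] => good p S
     | _ :: _ => true
  | k + 1, lo, S, W => (List.range' lo (Nat.sub p lo)).all fun a => force a fun a =>
      (free && inAP p a S) || allExtensions p free k (Nat.succ a) (a :: S) (win p a W)

/-- Pairs `(a, t)` which stand for the maps `s ↦ a s + t`. -/
def affineMaps (p : ℕ) : List (ℕ × ℕ) := (List.range' 1 (p / 2)).flatMap fun a => (List.range p).map fun t => (a, t)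

/-- `force` only fixes the order of evaluation: its recursor makes the kernel compute the numeral
before it is substituted. -/
theorem force_eq {α : Type} (n : ℕ) (k : ℕ → α) : force n k = k n := by cases n <;> rfl

theorem mem_foldr_of_mem_base {α β : Type} {g : α → List β → List β}
    (hg : ∀ x l, ∀ e ∈ l, e ∈ g x l) {e : β} {l : List β} (he : e ∈ l) :
    ∀ T : List α, e ∈ T.foldr g l
  | [] => he
  | x :: T => hg x _ e (mem_foldr_of_mem_base hg he T)

theorem mem_foldr_of_mem {α β : Type} {g : α → List β → List β}
    (hg : ∀ x l, ∀ e ∈ l, e ∈ g x l) {e : β} {x : α} (hx : ∀ l, e ∈ g x l) (l : List β) :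
    ∀ T : List α, x ∈ T → e ∈ T.foldr g l
  | y :: T, h => by
    rcases List.mem_cons.1 h with rfl | h
    · exact hx _
    · exact hg y _ e (mem_foldr_of_mem hg hx l T h)

variable {p m : ℕ} {T : List ℕ}

theorem mem_slopes {x z w : ℕ} (hx : x ∈ T) (hz : z ∈ T) (hw : w ∈ T) :
    (m + x = z + w → (x, z, 0) ∈ slopes p m T) ∧
      (p ≠ 0 → m + x = z + w + p → (x, z, m + p - w) ∈ slopes p m T) := by
  refine ⟨fun h => ?_, fun h0 h => ?_⟩ <;>
  · refine List.mem_flatMap.2 ⟨z, hz, List.mem_flatMap.2 ⟨w, hw, ?_⟩⟩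
    simp only [force_eq]
    refine mem_foldr_of_mem (fun y l e he => ?_) (fun l => ?_) _ T hx
    · cases Nat.beq (m.add y) (z.add w) <;>
        cases Nat.beq (m.add y) ((z.add w).add p) <;> simp [he]
    · have h1 : m.add x = m + x := rfl
      have h2 : z.add w = z + w := rfl
      have h3 : (z + w).add p = z + w + p := rfl
      have h4 : (m.add p).sub w = m + p - w := rfl
      simp only [h1, h2, h3, h4, h]
      have h5 : Nat.beq (z + w) (z + w) = true := by simp
      have h6 : Nat.beq (z + w + p) (z + w + p) = true := by simp
      have h7 : p ≠ 0 → Nat.beq (z + w + p) (z + w) = false := fun h =>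
        Bool.eq_false_iff.2 fun h => by simp at h; omega
      simp [*]

theorem mem_slopes_double {z w : ℕ} (hz : z ∈ T) (hw : w ∈ T) :
    (m + m = z + w → (w, z, 0) ∈ slopes p m T) ∧
      (p ≠ 0 → m + m = z + w + p → (w, z, m + p - w) ∈ slopes p m T) := by
  refine ⟨fun h => ?_, fun h0 h => ?_⟩ <;>
  · refine List.mem_flatMap.2 ⟨z, hz, List.mem_flatMap.2 ⟨w, hw, ?_⟩⟩
    simp only [force_eq]
    refine mem_foldr_of_mem_base (fun y l e he => ?_) ?_ T
    · cases Nat.beq (m.add y) (z.add w) <;>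
        cases Nat.beq (m.add y) ((z.add w).add p) <;> simp [he]
    · have h1 : m.add m = m + m := rfl
      have h2 : z.add w = z + w := rfl
      have h3 : (z + w).add p = z + w + p := rfl
      have h4 : (m.add p).sub w = m + p - w := rfl
      simp only [h1, h2, h3, h4, h]
      have h5 : Nat.beq (z + w) (z + w) = true := by simp
      have h6 : Nat.beq (z + w + p) (z + w + p) = true := by simp
      have h7 : p ≠ 0 → Nat.beq (z + w + p) (z + w) = false := fun h =>
        Bool.eq_false_iff.2 fun h => by simp at h; omega
      simp [*]

/-- `starGood` verifies the solution against all prescribed differences, so nothing has to be proved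
about `starSolve`. -/
theorem exists_of_starGood (h : starGood p m T = true) :
    ∃ ψ : ℕ → ℕ, ∀ c ∈ slopes p m T, ψ c.1 = (ψ c.2.1 + c.2.2) % p := by
  unfold starGood at h
  dsimp only at h
  split at h
  · simp at h
  · exact ⟨fun v => (lookup v (starSolve p (slopes p m T) (T.map fun v => (v, v, 0)))).2,
      fun c hc => Nat.eq_of_beq_eq_true (List.all_eq_true.1 h c hc)⟩

/-- `T'` and `B'` are the final accumulators: images in the lower half, and the at most one image
outside. They only grow during the recursion. -/
theorem exists_of_goodAt {a t : ℕ} (hp : 0 < p) : ∀ {S T B : List ℕ}, goodAt p a t S T B = true →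
    ∃ T' B' : List ℕ, (∀ u ∈ T', u ∈ T ∨ 2 * u < p) ∧ T ⊆ T' ∧ B ⊆ B' ∧ (∀ u ∈ B', u ∈ B ∨ u < p) ∧
      (∀ s ∈ S, a * (s + t) % p ∈ T' ∨ a * (s + t) % p ∈ B') ∧
        (B' = [] ∨ ∃ m, B' = [m] ∧ starGood p m T' = true)
  | [], T, [], _ => ⟨T, [], fun _ => .inl, by simp⟩
  | [], T, [m], h => ⟨T, [m], fun _ => .inl, by simpa [goodAt] using h⟩
  | [], _, _ :: _ :: _, h => by simp [goodAt] at h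
  | s :: S, T, B, h => by
    rw [goodAt, force_eq] at h
    change (bif Nat.blt (2 * (a * (s + t) % p)) p then _ else _) = true at h
    by_cases hu : 2 * (a * (s + t) % p) < p
    · have hu' : Nat.blt (2 * (a * (s + t) % p)) p = true := by simpa using hu
      rw [hu'] at h
      change goodAt p a t S (a * (s + t) % p :: T) B = true at h
      obtain ⟨T', B', h1, h2, h3, h4, h5, h6⟩ := exists_of_goodAt hp h
      refine ⟨T', B', fun u hu => ?_, fun u hu => h2 (List.mem_cons_of_mem _ hu), h3, h4, ?_, h6⟩
      · rcases h1 u hu with h | h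
        · rcases List.mem_cons.1 h with rfl | h
          · exact .inr ‹_›
          · exact .inl h
        · exact .inr h
      · intro r hr
        rcases List.mem_cons.1 hr with rfl | hr
        · exact .inl (h2 List.mem_cons_self)
        · exact h5 r hr
    · have hu' : Nat.blt (2 * (a * (s + t) % p)) p = false := by
        rw [Bool.eq_false_iff]; simpa using hu
      rw [hu', cond_false] at h
      match B, h with
      | [], h =>
        change goodAt p a t S T [a * (s + t) % p] = true at h
        obtain ⟨T', B', h1, h2, h3, h4, h5, h6⟩ := exists_of_goodAt hp h
        refine ⟨T', B', h1, h2, by simp, fun u hu => ?_, ?_, h6⟩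
        · rcases h4 u hu with h | h
          · rw [List.mem_singleton.1 h]
            exact .inr (Nat.mod_lt _ hp)
          · exact .inr h
        · intro r hr
          rcases List.mem_cons.1 hr with rfl | hr
          · exact .inr (h3 (by simp))
          · exact h5 r hr

theorem mem_win {a : ℕ} {c : ℕ × ℕ} : ∀ {W : List (ℕ × ℕ)}, c ∈ win p a W →
    c ∈ W ∧ 2 * ((c.1 * a + c.2) % p) < p
  | d :: W, h => by
    rw [win] at h
    change c ∈ bif Nat.blt (2 * ((d.1 * a + d.2) % p)) p then _ else _ at h
    by_cases hu : 2 * ((d.1 * a + d.2) % p) < p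
    · have hu' : Nat.blt (2 * ((d.1 * a + d.2) % p)) p = true := by simpa using hu
      rw [hu', cond_true] at h
      rcases List.mem_cons.1 h with rfl | h
      · exact ⟨List.mem_cons_self, hu⟩
      · exact ⟨List.mem_cons_of_mem _ (mem_win h).1, (mem_win h).2⟩
    · have hu' : Nat.blt (2 * ((d.1 * a + d.2) % p)) p = false := by
        rw [Bool.eq_false_iff]; simpa using hu
      rw [hu', cond_false] at h
      exact ⟨List.mem_cons_of_mem _ (mem_win h).1, (mem_win h).2⟩

variable [Fact p.Prime]

theorem tame_of_starGood (hT : ∀ u ∈ T, 2 * u < p) (hm : m < p) (h : starGood p m T = true)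
    {A : Set (ZMod p)} (hA : ∀ x ∈ A, x.val ∈ T ∨ x.val = m) : Tame A := by
  have hp : p ≠ 0 := (Fact.out : p.Prime).ne_zero
  obtain ⟨ψ, hψ⟩ := exists_of_starGood h
  have hv : (m : ZMod p).val = m := ZMod.val_cast_of_lt hm
  have hA' : ∀ x ∈ A, x ≠ (m : ZMod p) → x.val ∈ T := fun x hx hne =>
    (hA x hx).resolve_right fun h => hne (by rw [← h]; simp)
  have key : ∀ x z d : ℕ, (x, z, d) ∈ slopes p m T → (ψ x : ZMod p) - ψ z = d := fun x z d h => by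
    have := hψ _ h
    simp only at this
    rw [this]
    simp
  -- With `m < p` and all other residues in the lower half, at most one carry can occur. This is why
  -- `slopes` only lists the cases without carry and with one carry.
  have small : ∀ (d : ℤ) (n : ℤ), (p : ℤ) * d = n → -p < n → n < 2 * p → d = 0 ∨ d = 1 := by
    intro d n h h1 h2
    have hp' : (0 : ℤ) < p := by omega
    have h3 : -1 < d := lt_of_mul_lt_mul_left (a := (p : ℤ)) (by linarith) hp'.le
    have h4 : d < 2 := lt_of_mul_lt_mul_left (a := (p : ℤ)) (by linarith) hp'.le
    omega
  refine tame_of_star (m := (m : ZMod p)) (fun x hx hne => hT _ (hA' x hx hne))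
    (fun x => (ψ x.val : ZMod p)) ?_ ?_
  · intro x z w sx sz sw nx nz nw d hd
    rw [hv] at hd
    have tx := hA' x sx nx
    have tz := hA' z sz nz
    have tw := hA' w sw nw
    have := hT _ tx
    have := hT _ tz
    have := hT _ tw
    rcases small d _ hd (by omega) (by omega) with rfl | rfl
    · rw [key _ _ _ ((mem_slopes tx tz tw).1 (by omega))]
      simp
    · rw [key _ _ _ ((mem_slopes tx tz tw).2 hp (by omega)), Nat.cast_sub (by omega)]
      simp
  · intro z w sz sw nz nw d hd
    rw [hv] at hd
    have tz := hA' z sz nz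
    have tw := hA' w sw nw
    have := hT _ tz
    have := hT _ tw
    rcases small d _ hd (by omega) (by omega) with rfl | rfl
    · rw [key _ _ _ ((mem_slopes_double tz tw).1 (by omega))]
      simp
    · rw [key _ _ _ ((mem_slopes_double tz tw).2 hp (by omega)), Nat.cast_sub (by omega)]
      simp

theorem natCast_ne_zero {a : ℕ} (h0 : 0 < a) (h : a < p) : (a : ZMod p) ≠ 0 := fun h' =>
  absurd (Nat.le_of_dvd h0 ((ZMod.natCast_eq_zero_iff a p).1 h')) (by omega)

theorem tame_of_good {S : List ℕ} (h : good p S = true) {A : Set (ZMod p)}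
    (hA : ∀ x ∈ A, x.val ∈ S) : Tame A := by
  have hp : 0 < p := (Fact.out : p.Prime).pos
  simp only [good, List.any_eq_true, force_eq, List.mem_range'_1] at h
  obtain ⟨a, ⟨h1, h2⟩, r, -, h⟩ := h
  obtain ⟨T', B', k1, -, -, k4, k5, k6⟩ := exists_of_goodAt hp h
  generalize p.sub r = t at k5
  have hv : ∀ x : ZMod p, ((a : ZMod p) * x + a * t).val = a * (x.val + t) % p := fun x => by
    rw [← ZMod.val_natCast]
    push_cast
    simp [mul_add]
  refine Tame.of_affine (T := (fun x => (a : ZMod p) * x + a * t) '' A)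
    (natCast_ne_zero (p := p) h1 (by omega)) (fun x hx => ⟨x, hx, rfl⟩) ?_
  rcases k6 with rfl | ⟨m, rfl, k6⟩
  · refine tame_of_half ?_
    rintro _ ⟨x, hx, rfl⟩
    simp only [hv]
    have := k5 _ (hA x hx)
    simp only [List.not_mem_nil, or_false] at this
    simpa using k1 _ this
  · refine tame_of_starGood (by simpa using k1) (by simpa using k4) k6 ?_
    rintro _ ⟨x, hx, rfl⟩
    simp only [hv]
    simpa using k5 _ (hA x hx)

theorem mem_affineMaps {c : ℕ × ℕ} (h : c ∈ affineMaps p) : 0 < c.1 ∧ c.1 < p := by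
  have hp : 0 < p := (Fact.out : p.Prime).pos
  simp only [affineMaps, List.mem_flatMap, List.mem_map, List.mem_range'_1] at h
  obtain ⟨a, ⟨h1, h2⟩, t, -, rfl⟩ := h
  dsimp only
  omega

/-- `R` is the increasing list of the elements still to be added, which the enumeration consumes
from the front. The maps in `W` send all elements added so far to the lower half; any survivor at
the end proves tameness. -/
theorem tame_of_allExtensions {free : Bool} {A : Set (ZMod p)} :
    ∀ {k lo : ℕ} {S : List ℕ} {W : List (ℕ × ℕ)}, allExtensions p free k lo S W = true →
    (∀ c ∈ W, (0 < c.1 ∧ c.1 < p) ∧ ∀ s ∈ S, 2 * ((c.1 * s + c.2) % p) < p) →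
    ∀ {R : List ℕ}, R.Pairwise (· < ·) → R.length = k → (∀ r ∈ R, lo ≤ r ∧ r < p) →
    (free = true → ∀ a b c : ℕ, a ∈ R ∨ a ∈ S → b ∈ R ∨ b ∈ S → c ∈ R ∨ c ∈ S →
      (a + b) % p = (c + c) % p → b = c) →
    (∀ x ∈ A, x.val ∈ R ∨ x.val ∈ S) → Tame A
  | 0, lo, S, W, h, hW, R, _, hk, _, _, hA => by
    obtain rfl := List.length_eq_zero_iff.1 hk
    simp only [List.not_mem_nil, false_or] at hA
    match W, h with
    | [], h => exact tame_of_good h hA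
    | c :: W, _ =>
      obtain ⟨⟨h1, h2⟩, h3⟩ := hW c List.mem_cons_self
      refine Tame.of_affine (T := (fun x => (c.1 : ZMod p) * x + c.2) '' A)
        (natCast_ne_zero (p := p) h1 h2) (fun x hx => ⟨x, hx, rfl⟩) (tame_of_half ?_)
      rintro _ ⟨x, hx, rfl⟩
      have hv : ((c.1 : ZMod p) * x + c.2).val = (c.1 * x.val + c.2) % p := by
        rw [← ZMod.val_natCast]
        push_cast
        simp
      simp only [hv]
      exact h3 _ (hA x hx)
  | k + 1, lo, S, W, h, hW, a :: R, hR, hk, hlo, hf, hA => by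
    obtain ⟨l1, l2⟩ := hlo a List.mem_cons_self
    have h := List.all_eq_true.1 h a (List.mem_range'_1.2 ⟨l1, by simp only [Nat.sub_eq]; omega⟩)
    rw [force_eq, Bool.or_eq_true] at h
    rw [List.pairwise_cons] at hR
    rcases h with h | h
    -- A branch skipped because of an arithmetic progression contradicts `hf`. The second case is
    -- the progression with `a` in the middle, for which `hf` is applied twice.
    · exfalso
      obtain ⟨hfree, h⟩ := Bool.and_eq_true_iff.1 h
      simp only [inAP, List.any_eq_true] at h
      obtain ⟨b, hb, c, hc, h⟩ := h
      by_cases hbc : b = c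
      · subst hbc; simp at h
      · have hbc' : Nat.beq b c = false := by rw [Bool.eq_false_iff]; simpa using hbc
        rw [hbc', cond_false, Bool.or_eq_true] at h
        replace h := h.imp Nat.eq_of_beq_eq_true Nat.eq_of_beq_eq_true
        have hf := hf hfree
        have ha : a ∈ a :: R ∨ a ∈ S := .inl List.mem_cons_self
        rcases h with h | h
        · exact hbc (hf a b c ha (.inr hb) (.inr hc) h)
        · refine hbc ((hf c b a (.inr hc) (.inr hb) ha ?_).trans (hf b c a (.inr hb) (.inr hc) ha h).symm)
          rw [add_comm c b]
          exact h
    · refine tame_of_allExtensions (k := k) (R := R) h (fun c hc => ?_) hR.2 (by simpa using hk)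
        (fun r hr => ⟨hR.1 r hr, (hlo r (List.mem_cons_of_mem _ hr)).2⟩) (fun hfr x y z hx hy hz =>
          hf hfr x y z ?_ ?_ ?_) (fun x hx => ?_)
      · obtain ⟨h1, h2⟩ := mem_win hc
        refine ⟨(hW c h1).1, fun s hs => ?_⟩
        rcases List.mem_cons.1 hs with rfl | hs
        · exact h2
        · exact (hW c h1).2 s hs
      all_goals grind

end Palette


/-! ### Reduction of arbitrary sets of residues to the finite checks -/

namespace Palette

variable {p : ℕ} [Fact p.Prime]

/-- The elements of `B` outside `S`, as sorted natural representatives, form the list that the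
enumeration runs through. -/
theorem tame_of_allExtensions_sdiff {free : Bool} {k lo : ℕ} {S : List ℕ} {W : List (ℕ × ℕ)}
    (h : allExtensions p free k lo S W = true)
    (hW : ∀ c ∈ W, (0 < c.1 ∧ c.1 < p) ∧ ∀ s ∈ S, 2 * ((c.1 * s + c.2) % p) < p)
    (hS : S.Nodup) {B : Finset (ZMod p)} (hB : B.card = k + S.length)
    (hSB : ∀ s ∈ S, s < p ∧ (s : ZMod p) ∈ B) (hlo : ∀ n, lo ≤ n ∨ n ∈ S)
    (hf : free = true → ∀ x ∈ B, ∀ y ∈ B, ∀ z ∈ B, x + z = y + y → z = y) :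
    Tame (B : Set (ZMod p)) := by
  set N : Finset ℕ := B.image ZMod.val with hN
  have hNcard : N.card = k + S.length := by
    rw [hN, Finset.card_image_of_injective _ (ZMod.val_injective p), hB]
  have hSN : S.toFinset ⊆ N := fun s hs => by
    obtain ⟨h1, h2⟩ := hSB s (List.mem_toFinset.1 hs)
    exact Finset.mem_image.2 ⟨_, h2, ZMod.val_cast_of_lt h1⟩
  have hNlt : ∀ n ∈ N, n < p := fun n hn => by
    obtain ⟨x, -, rfl⟩ := Finset.mem_image.1 hn
    exact ZMod.val_lt x
  have hNB : ∀ n ∈ N, (n : ZMod p) ∈ B := fun n hn => by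
    obtain ⟨x, hx, rfl⟩ := Finset.mem_image.1 hn
    simpa using hx
  have hmem : ∀ n, n ∈ (N \ S.toFinset).sort ∨ n ∈ S ↔ n ∈ N := fun n => by
    rw [Finset.mem_sort, Finset.mem_sdiff, List.mem_toFinset]
    constructor
    · rintro (h | h)
      · exact h.1
      · exact hSN (List.mem_toFinset.2 h)
    · intro h
      by_cases h' : n ∈ S
      · exact .inr h'
      · exact .inl ⟨h, h'⟩
  refine tame_of_allExtensions h hW (R := (N \ S.toFinset).sort) (Finset.sortedLT_sort _).pairwise ?_
    (fun r hr => ?_) (fun hfree a b c ha hb hc habc => ?_) (fun x hx => (hmem _).2 (Finset.mem_image_of_mem _ hx))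
  · rw [Finset.length_sort, Finset.card_sdiff_of_subset hSN, List.toFinset_card_of_nodup hS, hNcard]
    omega
  · obtain ⟨h1, h2⟩ := Finset.mem_sdiff.1 ((Finset.mem_sort _).1 hr)
    exact ⟨(hlo r).resolve_right fun h => h2 (List.mem_toFinset.2 h), hNlt r h1⟩
  · rw [hmem] at ha hb hc
    have e : (a + b : ZMod p) = c + c := by
      have := (ZMod.natCast_eq_natCast_iff' _ _ p).2 habc
      exact_mod_cast this
    have := hf hfree _ (hNB a ha) _ (hNB c hc) _ (hNB b hb) e
    rwa [ZMod.natCast_eq_natCast_iff', Nat.mod_eq_of_lt (hNlt b hb), Nat.mod_eq_of_lt (hNlt c hc)] at this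

/-- Finite checks imply that all sets of `k + 2` residues are tame: such a set either contains an
arithmetic progression, which an affine map sends to `0, 1, 2`, or is free of those. -/
theorem tame_of_checks {k : ℕ} (h2 : 2 < p)
    (c1 : allExtensions p false (k - 1) 3 [2, 1, 0] (win p 0 <| win p 1 <| win p 2 (affineMaps p)) = true)
    (c2 : allExtensions p true k 2 [1, 0] (win p 0 <| win p 1 (affineMaps p)) = true)
    (hk : 0 < k) {B : Finset (ZMod p)} (hB : B.card = k + 2) : Tame (B : Set (ZMod p)) := by
  have affine : ∀ x y : ZMod p, x ≠ y → ∃ C : Finset (ZMod p), C.card = B.card ∧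
      (∀ u ∈ B, (y - x)⁻¹ * u + -(y - x)⁻¹ * x ∈ C) ∧
        (∀ v ∈ C, (y - x) * v + x ∈ B) ∧ (Tame (C : Set (ZMod p)) → Tame (B : Set (ZMod p))) := by
    intro x y hxy
    have hd : y - x ≠ 0 := sub_ne_zero.2 hxy.symm
    refine ⟨B.image fun u => (y - x)⁻¹ * u + -(y - x)⁻¹ * x, ?_, ?_, ?_, ?_⟩
    · refine Finset.card_image_of_injective _ fun u v huv => ?_
      simpa [hd] using huv
    · exact fun u hu => Finset.mem_image_of_mem _ hu
    · intro v hv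
      obtain ⟨u, hu, rfl⟩ := Finset.mem_image.1 hv
      convert hu using 1
      field_simp
      ring
    · exact Tame.of_affine (inv_ne_zero hd) fun u hu => Finset.mem_image_of_mem _ hu
  by_cases hAP : ∃ x ∈ B, ∃ y ∈ B, ∃ z ∈ B, x + z = y + y ∧ z ≠ y
  · obtain ⟨x, hx, y, hy, z, hz, e, hne⟩ := hAP
    have hxy : x ≠ y := by
      rintro rfl
      exact hne (add_left_cancel e)
    have hd : y - x ≠ 0 := sub_ne_zero.2 hxy.symm
    -- The affine map with `x ↦ 0` and `y ↦ 1` sends `z = 2 y - x` to `2`.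
    obtain ⟨C, hC, h1, -, h3⟩ := affine x y hxy
    have m0 : (0 : ZMod p) ∈ C := by
      convert h1 x hx using 1
      ring
    have m1 : (1 : ZMod p) ∈ C := by
      convert h1 y hy using 1
      field_simp
      ring
    have m2 : (2 : ZMod p) ∈ C := by
      convert h1 z hz using 1
      field_simp
      linear_combination -e
    refine h3 (tame_of_allExtensions_sdiff c1 (fun c hc => ?_) (by decide) ?_ ?_ ?_ (by simp))
    · obtain ⟨hc, k0⟩ := mem_win hc
      obtain ⟨hc, k1⟩ := mem_win hc
      obtain ⟨hc, k2⟩ := mem_win hc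
      exact ⟨mem_affineMaps hc, by simp only [List.mem_cons, List.not_mem_nil, or_false]; rintro s (rfl | rfl | rfl) <;> assumption⟩
    · rw [hC, hB]
      simp only [List.length_cons, List.length_nil]
      omega
    · simp only [List.mem_cons, List.not_mem_nil, or_false]
      rintro s (rfl | rfl | rfl)
      · exact ⟨h2, by exact_mod_cast m2⟩
      · exact ⟨by omega, by exact_mod_cast m1⟩
      · exact ⟨by omega, by exact_mod_cast m0⟩
    · intro n
      simp only [List.mem_cons, List.not_mem_nil, or_false]
      omega
  · push Not at hAP
    obtain ⟨x, hx, y, hy, hxy⟩ := Finset.one_lt_card.1 (show 1 < B.card by omega)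
    have hd : y - x ≠ 0 := sub_ne_zero.2 hxy.symm
    obtain ⟨C, hC, h1, h4, h3⟩ := affine x y hxy
    have m0 : (0 : ZMod p) ∈ C := by
      convert h1 x hx using 1
      ring
    have m1 : (1 : ZMod p) ∈ C := by
      convert h1 y hy using 1
      field_simp
      ring
    refine h3 (tame_of_allExtensions_sdiff c2 (fun c hc => ?_) (by decide) ?_ ?_ ?_ ?_)
    · obtain ⟨hc, k0⟩ := mem_win hc
      obtain ⟨hc, k1⟩ := mem_win hc
      exact ⟨mem_affineMaps hc, by simp only [List.mem_cons, List.not_mem_nil, or_false]; rintro s (rfl | rfl) <;> assumption⟩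
    · rw [hC, hB]
      simp
    · simp only [List.mem_cons, List.not_mem_nil, or_false]
      rintro s (rfl | rfl)
      · exact ⟨by omega, by exact_mod_cast m1⟩
      · exact ⟨by omega, by exact_mod_cast m0⟩
    · intro n
      simp only [List.mem_cons, List.not_mem_nil, or_false]
      omega
    · intro _ u hu v hv w hw e
      have := hAP _ (h4 u hu) _ (h4 v hv) _ (h4 w hw) (by linear_combination (y - x) * e)
      exact mul_left_cancel₀ hd (add_right_cancel this)

/-! ### The finite checks for the primes 7, 11, 13, 19, 23, 29, 31 -/

section Checks

set_option maxRecDepth 100000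

theorem check_progression_7 : allExtensions 7 false 1 3 [2, 1, 0]
    (win 7 0 <| win 7 1 <| win 7 2 (affineMaps 7)) = true := by decide +kernel

theorem check_free_7 : allExtensions 7 true 2 2 [1, 0]
    (win 7 0 <| win 7 1 (affineMaps 7)) = true := by decide +kernel

theorem check_progression_11 : allExtensions 11 false 2 3 [2, 1, 0]
    (win 11 0 <| win 11 1 <| win 11 2 (affineMaps 11)) = true := by decide +kernel

theorem check_free_11 : allExtensions 11 true 3 2 [1, 0]
    (win 11 0 <| win 11 1 (affineMaps 11)) = true := by decide +kernel

theorem check_progression_13 : allExtensions 13 false 2 3 [2, 1, 0]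
    (win 13 0 <| win 13 1 <| win 13 2 (affineMaps 13)) = true := by decide +kernel

theorem check_free_13 : allExtensions 13 true 3 2 [1, 0]
    (win 13 0 <| win 13 1 (affineMaps 13)) = true := by decide +kernel

theorem check_progression_19 : allExtensions 19 false 3 3 [2, 1, 0]
    (win 19 0 <| win 19 1 <| win 19 2 (affineMaps 19)) = true := by decide +kernel

theorem check_free_19 : allExtensions 19 true 4 2 [1, 0]
    (win 19 0 <| win 19 1 (affineMaps 19)) = true := by decide +kernel

theorem check_progression_23 : allExtensions 23 false 3 3 [2, 1, 0]
    (win 23 0 <| win 23 1 <| win 23 2 (affineMaps 23)) = true := by decide +kernel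

theorem check_free_23 : allExtensions 23 true 4 2 [1, 0]
    (win 23 0 <| win 23 1 (affineMaps 23)) = true := by decide +kernel

theorem check_progression_29 : allExtensions 29 false 3 3 [2, 1, 0]
    (win 29 0 <| win 29 1 <| win 29 2 (affineMaps 29)) = true := by decide +kernel

theorem check_free_29 : allExtensions 29 true 4 2 [1, 0]
    (win 29 0 <| win 29 1 (affineMaps 29)) = true := by decide +kernel

theorem check_progression_31 : allExtensions 31 false 3 3 [2, 1, 0]
    (win 31 0 <| win 31 1 <| win 31 2 (affineMaps 31)) = true := by decide +kernel

theorem check_free_31 : allExtensions 31 true 4 2 [1, 0]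
    (win 31 0 <| win 31 1 (affineMaps 31)) = true := by decide +kernel

end Checks

end Palette

theorem tame_of_card {p : ℕ} [Fact p.Prime] (h5 : 5 < p) (h32 : p < 2 ^ 5) (h17 : p ≠ 17)
    {B : Finset (ZMod p)} (hB : B.card = Nat.log 2 p + 2) : Tame (B : Set (ZMod p)) := by
  have hp : p.Prime := Fact.out
  have hk : 0 < Nat.log 2 p := Nat.log_pos (by omega) (by omega)
  refine Palette.tame_of_checks (by omega) ?_ ?_ hk hB <;> clear hB hk
  all_goals
    clear * - hp h5 h32 h17
    norm_num at h32
    interval_cases p <;> first | exact absurd hp (by decide) | omega | skip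
  all_goals norm_num [Nat.log]
  exacts [Palette.check_progression_7, Palette.check_progression_11, Palette.check_progression_13,
    Palette.check_progression_19, Palette.check_progression_23, Palette.check_progression_29,
    Palette.check_progression_31, Palette.check_free_7, Palette.check_free_11, Palette.check_free_13,
    Palette.check_free_19, Palette.check_free_23, Palette.check_free_29, Palette.check_free_31]


/-! ### The bound for the number of colors -/

/-- A coloring with tame colors leads to a nontrivial coloring of weight zero. -/
theorem DehnColoring.hasZero {p : ℕ} {D : KnotDiagram} (C : DehnColoring p D)
    (hC : C.Nontrivial) (hT : Tame C.colors) : ∃ h : ZMod p → ℤ, IsLift h ∧ HasZero h D.word := by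
  obtain ⟨h, hh, φ, hφ, H⟩ := hT
  obtain ⟨f, hf, hfj, hw⟩ := exists_corners D.gauss C.color
  have hbal : ∀ n, (f n).Balanced := fun n => by
    rcases hf n with e | ⟨j, i, hji, e⟩
    · rw [e]; rfl
    · rw [e]; exact C.crossing_condition j i hji
  have hcol : ∀ x ∈ D.word, ∃ j, f x.crossing = cornersAt C.color j := fun x hx => by
    obtain ⟨k, rfl⟩ := List.get_of_mem hx
    obtain ⟨k', ⟨hk, -⟩ | ⟨hk, -⟩⟩ := isCrossing_or D.gauss k
    · exact ⟨_, hfj _ _ hk⟩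
    · exact ⟨k', by rw [← hfj _ _ hk, hk.crossing_eq]⟩
  refine ⟨h, hh, f, hbal, ⟨_, hw⟩, ?_, wordWeight_eq_zero D.gauss hw hφ fun x hx => ?_⟩
  · obtain ⟨j, i, hji, hne⟩ := hC
    refine ⟨_, List.get_mem _ j, ?_⟩
    rw [hfj j i hji]
    exact hne
  · obtain ⟨j, e⟩ := hcol x hx
    have hr := hbal x.crossing
    rw [e] at hr ⊢
    exact H _ hr ⟨_, rfl⟩ ⟨_, rfl⟩ ⟨_, rfl⟩ ⟨_, rfl⟩

/-- Enlarge the set to exactly `Nat.log 2 p + 2` residues, the size covered by the checks; tameness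
passes back to the subset. -/
theorem tame_of_ncard_le {p : ℕ} [Fact p.Prime] (h5 : 5 < p) (h32 : p < 2 ^ 5) (h17 : p ≠ 17)
    {S : Set (ZMod p)} (hS : S.ncard ≤ Nat.log 2 p + 2) : Tame S := by
  classical
  have hl : Nat.log 2 p + 2 ≤ p := by
    have h1 : Nat.log 2 p < 5 := Nat.log_lt_of_lt_pow (by omega) h32
    by_cases h : p = 6
    · exact absurd (Fact.out : p.Prime) (by subst h; decide)
    · omega
  obtain ⟨B, hB, -, hcard⟩ := Finset.exists_subsuperset_card_eq
    (Finset.subset_univ S.toFinite.toFinset) (n := Nat.log 2 p + 2)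
    (by rwa [← Set.ncard_eq_toFinset_card S S.toFinite]) (by rwa [Finset.card_univ, ZMod.card])
  exact Tame.mono (fun x hx => hB (by simpa using hx)) (tame_of_card h5 h32 h17 hcard)

theorem mainTheorem7 (p : ℕ) [Fact p.Prime] (h5 : 5 < p) (h32 : p < 2 ^ 5) (h17 : p ≠ 17)
    (K : Knot) (hK : K.DehnColorable p) (D : KnotDiagram) (hD : D.IsDiagramOf K)
    (h0 : (0 : ZMod p) ∉ shadowCocycleInvariantNT (mochizuki p) D) :
    Nat.log 2 p + 3 ≤ K.mincol p := by
  obtain ⟨D₀, hD₀, C₀, hC₀⟩ := hK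
  -- Colorability makes the set of color numbers nonempty, so `mincol` is attained by an actual
  -- coloring rather than being the default value `0`.
  obtain ⟨D', hD', C, hC, hn⟩ := Nat.sInf_mem (s := {n | ∃ D : KnotDiagram, D.IsDiagramOf K ∧
    ∃ C : DehnColoring p D, C.Nontrivial ∧ C.colors.ncard = n}) ⟨_, D₀, hD₀, C₀, hC₀, rfl⟩
  change C.colors.ncard = K.mincol p at hn
  by_contra hlt
  -- The lift `h` comes from the colors of `C`; the invariance of `HasZero` for every lift lets it
  -- be carried from `D'` to `D`.
  obtain ⟨h, hh, H⟩ := C.hasZero hC (tame_of_ncard_le h5 h32 h17 (by omega))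
  exact h0 (zero_mem_of_hasZero (by omega) hh ((hasZero_iff_of_isDiagramOf hh hD' hD).1 H))
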